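/- **Theorem 2.3.** Let $n,\rho,m\ge 0$ be integers with $n-\rho=2m$ and let $a>0$ be real. *Kasteleyn matrix.* The dual graph of the double Aztec diamond of size $n$ and overlap $\rho$ has the white vertices $\mathtt W_{AD}$, the $(x_1,x_2)$ with $x_1$ odd, $x_2$ even and either $1\le x_1\le 2(2m+n)+1,\ 0\le x_2\le 2(n-1)$, or $1\le x_1\le 2n-1,\ x_2=2n$; and the black vertices $\mathtt B_{AD}$, the $(x_1,x_2)$ with $x_1$ even, $x_2$ odd and either $0\le x_1\le 2(2m+n),\ 1\le x_2\le 2n-1$, or $2(2m+1)\le x_1\le 2(2m+n),\ x_2=-1$. With $e_1=(1,1)$, $e_2=(-1,1)$, $\alpha(1)=1$, $\alpha(2)=-a\mathrm i$, the Kasteleyn matrix $K_a$ (rows: black, columns: white) has the entries, for $\mathtt b=(b_1,b_2)$ and $r=1,2$, $$K_a(\mathtt b,\mathtt w)=\begin{cases}(-1)^{-(b_1+b_2+1)/2}\alpha(r)&\mathtt w=\mathtt b+e_r,\\(-1)^{-(b_1+b_2-1)/2}\alpha(r)&\mathtt w=\mathtt b-e_r,\\0&\text{otherwise.}\end{cases}$$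 *Kernel.* Let $\oint_{\Gamma_{0,a}}du\oint_{\Gamma_{0,a,u}}dv$ denote integration over positively oriented circles, the inner one (for $u$) enclosing $0,a$, the outer concentric one (for $v$) enclosing $0,a$ and the $u$-circle, and neither enclosing $-1/a$. For integers $z_1=2r+\varepsilon_1$, $z_2=2s+\varepsilon_2$ with $\varepsilon_i\in\{0,1\}$ and integers $x,y,j,k$ put $$\psi_{z_1,z_2}(x,y)=\oint_{\Gamma_{0,a}}\frac{dz}{2\pi\mathrm i z}\,z^{x-y}\frac{(1+az)^{s-r}}{(1-\frac az)^{s-r+\varepsilon_2-\varepsilon_1}},$$ $$S(z_1,x;z_2,y)=\frac{(-1)^{x-y}}{(2\pi\mathrm i)^2}\oint_{\Gamma_{0,a}}du\oint_{\Gamma_{0,a,u}}\frac{dv}{v-u}\,\frac{v^{x-m-1}}{u^{y-m}}\,\frac{(1+au)^s(1-\frac au)^{n-s+1-\varepsilon_2}}{(1+av)^r(1-\frac av)^{n-r+1-\varepsilon_1}},$$ $$a_{x,z_2}(k)=\frac{(-1)^{k-x}}{(2\pi\mathrm i)^2}\oint_{\Gamma_{0,a}}du\oint_{\Gamma_{0,a,u}}\frac{dv}{u-v}\,\frac{v^{x+m}}{u^{k+1}}\,\frac{(1+av)^s(1-\frac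 av)^{n-s+1-\varepsilon_2}}{(1+au)^n(1-\frac au)^{n+1}},$$ $$b_{y,z_1}(k)=\frac{(-1)^{k-y}}{(2\pi\mathrm i)^2}\oint_{\Gamma_{0,a}}du\oint_{\Gamma_{0,a,u}}\frac{dv}{v-u}\,\frac{v^{k}}{u^{y+m+1}}\,\frac{(1+av)^n(1-\frac av)^{n+1}}{(1+au)^r(1-\frac au)^{n-r+1-\varepsilon_1}},$$ $$K_n(j,k)=\frac{(-1)^{j+k}}{(2\pi\mathrm i)^2}\oint_{\Gamma_{0,a}}dw\oint_{\Gamma_{0,a,w}}\frac{dz}{z-w}\,\frac{z^{n-j}(1+aw)^n(w-a)^{n+1}}{w^{n+1-k}(1+az)^n(z-a)^{n+1}}.$$ The $\mathbb K$-particle kernel of the double Aztec diamond is defined by $$(-1)^{x-y}\,\mathbb K_{n,\rho}(z_1,x;z_2,y)=-\mathbb 1_{z_2<z_1}(-1)^{x-y}\psi_{z_1,z_2}(x,y)+S(z_1,x;z_2,y)-\sum_{k\ge n-\rho+1}\bigl((\mathbb 1-K_n)^{-1}_{\ge n-\rho+1}a_{-y,z_2}\bigr)(k)\,b_{-x,z_1}(k),$$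 where $(\mathbb 1-K_n)^{-1}_{\ge n-\rho+1}$ is the inverse of the infinite matrix $\mathbb 1-K_n$ acting on complex sequences on $\{k\in\mathbb Z:k\ge n-\rho+1\}$. *Claim.* For every sequence $f$ on $\{k\ge n-\rho+1\}$ there is exactly one sequence $g$ with $g-K_ng=f$ (all row sums converging), so that $(\mathbb 1-K_n)^{-1}_{\ge n-\rho+1}$ is well defined; for all $\mathtt b\in\mathtt B_{AD}$, $\mathtt w\in\mathtt W_{AD}$ the series over $k$ in the kernel below converges absolutely; and $K_a$ is invertible, its two-sided inverse having the entries $$K_a^{-1}(\mathtt w,\mathtt b)=-(-1)^{(w_1-w_2+b_1-b_2+2)/4}\,\mathbb K_{n,\rho}\Bigl(b_2+1,\tfrac{b_2-b_1+2m+1}{2};\,w_2+1,\tfrac{w_2-w_1+2m+1}{2}\Bigr),$$ with $(-1)^{1/2}=\mathrm i$. -/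

import Mathlib

open Complex

noncomputable section

namespace DoubleAztec

/-! ### The dual graph and the Kasteleyn matrix -/

/-- White vertices of the dual graph of the double Aztec diamond of size `n` with overlap
`n - 2 * m`. The box is only there to have a finite set; see `mem_whiteAD`. -/
def whiteAD (n m : ℕ) : Finset (ℤ × ℤ) :=
  (Finset.Icc (1 : ℤ) (2 * (2 * m + n) + 1) ×ˢ Finset.Icc (0 : ℤ) (2 * n)).filter fun p =>
    Odd p.1 ∧ Even p.2 ∧
      ((1 ≤ p.1 ∧ p.1 ≤ 2 * (2 * (m : ℤ) + n) + 1 ∧ 0 ≤ p.2 ∧ p.2 ≤ 2 * ((n : ℤ) - 1)) ∨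
        (1 ≤ p.1 ∧ p.1 ≤ 2 * (n : ℤ) - 1 ∧ p.2 = 2 * (n : ℤ)))

/-- Black vertices of the dual graph of the double Aztec diamond. -/
def blackAD (n m : ℕ) : Finset (ℤ × ℤ) :=
  (Finset.Icc (0 : ℤ) (2 * (2 * m + n)) ×ˢ Finset.Icc (-1 : ℤ) (2 * n)).filter fun p =>
    Even p.1 ∧ Odd p.2 ∧
      ((0 ≤ p.1 ∧ p.1 ≤ 2 * (2 * (m : ℤ) + n) ∧ 1 ≤ p.2 ∧ p.2 ≤ 2 * (n : ℤ) - 1) ∨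
        (2 * (2 * (m : ℤ) + 1) ≤ p.1 ∧ p.1 ≤ 2 * (2 * (m : ℤ) + n) ∧ p.2 = -1))

theorem mem_whiteAD (n m : ℕ) (p : ℤ × ℤ) : p ∈ whiteAD n m ↔
    Odd p.1 ∧ Even p.2 ∧
      ((1 ≤ p.1 ∧ p.1 ≤ 2 * (2 * (m : ℤ) + n) + 1 ∧ 0 ≤ p.2 ∧ p.2 ≤ 2 * ((n : ℤ) - 1)) ∨
        (1 ≤ p.1 ∧ p.1 ≤ 2 * (n : ℤ) - 1 ∧ p.2 = 2 * (n : ℤ))) := by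
  simp only [whiteAD, Finset.mem_filter, Finset.mem_product, Finset.mem_Icc]
  constructor
  · exact fun h => h.2
  · refine fun h => ⟨?_, h⟩
    obtain ⟨-, -, h | h⟩ := h <;> omega

theorem mem_blackAD (n m : ℕ) (p : ℤ × ℤ) : p ∈ blackAD n m ↔
    Even p.1 ∧ Odd p.2 ∧
      ((0 ≤ p.1 ∧ p.1 ≤ 2 * (2 * (m : ℤ) + n) ∧ 1 ≤ p.2 ∧ p.2 ≤ 2 * (n : ℤ) - 1) ∨
        (2 * (2 * (m : ℤ) + 1) ≤ p.1 ∧ p.1 ≤ 2 * (2 * (m : ℤ) + n) ∧ p.2 = -1)) := by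
  simp only [blackAD, Finset.mem_filter, Finset.mem_product, Finset.mem_Icc]
  constructor
  · exact fun h => h.2
  · refine fun h => ⟨?_, h⟩
    obtain ⟨-, -, h | h⟩ := h <;> omega

/-- The entry `K_a(b, w)`, with `e₁ = (1, 1)`, `e₂ = (-1, 1)`, `α(1) = 1`, `α(2) = -a i`.
For black `b` the exponents are integers, i.e. the divisions by `2` are exact. -/
def kasteleynEntry (a : ℝ) (b w : ℤ × ℤ) : ℂ :=
  if w = b + (1, 1) then (-1 : ℂ) ^ (-(b.1 + b.2 + 1) / 2)
  else if w = b + (-1, 1) then (-1 : ℂ) ^ (-(b.1 + b.2 + 1) / 2) * (-(a : ℂ) * I)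
  else if w = b - (1, 1) then (-1 : ℂ) ^ (-(b.1 + b.2 - 1) / 2)
  else if w = b - (-1, 1) then (-1 : ℂ) ^ (-(b.1 + b.2 - 1) / 2) * (-(a : ℂ) * I)
  else 0

/-- The Kasteleyn matrix: rows indexed by black vertices, columns by white vertices. -/
def kasteleyn (a : ℝ) (n m : ℕ) : Matrix (blackAD n m) (whiteAD n m) ℂ :=
  Matrix.of fun b w => kasteleynEntry a b w

/-! ### Contour integrals

`innerInt` is `(2πi)⁻¹ ∮` over a contour `Γ_{0,a}`, a positively oriented circle which encloses
`0` and `a` but not `-1/a`. `outerInt` is the same over a larger concentric circle; it encloses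
`0`, `a` and every point `u` of the inner circle (so it is `Γ_{0,a,u}`), but not `-1/a`. -/

def innerInt (a : ℝ) (f : ℂ → ℂ) : ℂ :=
  (2 * (Real.pi : ℂ) * I)⁻¹ * ∮ z in C((a : ℂ) / 2, a / 2 + 1 / (3 * a)), f z

def outerInt (a : ℝ) (f : ℂ → ℂ) : ℂ :=
  (2 * (Real.pi : ℂ) * I)⁻¹ * ∮ z in C((a : ℂ) / 2, a / 2 + 2 / (3 * a)), f z

/-! ### The ingredients of the kernel

A first coordinate `z : ℤ` is written `z = 2 r + ε` with `r = z / 2`, `ε = z % 2 ∈ {0, 1}`. -/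

/-- `ψ_{z₁, z₂}(x, y)` with `z₁ = 2r + ε₁`, `z₂ = 2s + ε₂`. -/
def psi (a : ℝ) (z₁ z₂ x y : ℤ) : ℂ :=
  innerInt a fun z =>
    1 / z * z ^ (x - y) * (1 + a * z) ^ (z₂ / 2 - z₁ / 2) /
      (1 - a / z) ^ (z₂ / 2 - z₁ / 2 + z₂ % 2 - z₁ % 2)

/-- `S(z₁, x; z₂, y)` with `z₁ = 2r + ε₁`, `z₂ = 2s + ε₂`. -/
def S (a : ℝ) (n m : ℕ) (z₁ x z₂ y : ℤ) : ℂ :=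
  (-1 : ℂ) ^ (x - y) * innerInt a fun u => outerInt a fun v =>
    1 / (v - u) * (v ^ (x - m - 1) / u ^ (y - m)) *
      ((1 + a * u) ^ (z₂ / 2) * (1 - a / u) ^ ((n : ℤ) - z₂ / 2 + 1 - z₂ % 2)) /
      ((1 + a * v) ^ (z₁ / 2) * (1 - a / v) ^ ((n : ℤ) - z₁ / 2 + 1 - z₁ % 2))

/-- `a_{x, z}(k)` with `z = 2s + ε`. -/
def aFun (a : ℝ) (n m : ℕ) (x z k : ℤ) : ℂ :=
  (-1 : ℂ) ^ (k - x) * innerInt a fun u => outerInt a fun v =>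
    1 / (u - v) * (v ^ (x + m) / u ^ (k + 1)) *
      ((1 + a * v) ^ (z / 2) * (1 - a / v) ^ ((n : ℤ) - z / 2 + 1 - z % 2)) /
      ((1 + a * u) ^ n * (1 - a / u) ^ (n + 1))

/-- `b_{y, z}(l)` with `z = 2r + ε`. -/
def bFun (a : ℝ) (n m : ℕ) (y z l : ℤ) : ℂ :=
  (-1 : ℂ) ^ (l - y) * innerInt a fun u => outerInt a fun v =>
    1 / (v - u) * (v ^ l / u ^ (y + m + 1)) *
      ((1 + a * v) ^ n * (1 - a / v) ^ (n + 1)) /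
      ((1 + a * u) ^ (z / 2) * (1 - a / u) ^ ((n : ℤ) - z / 2 + 1 - z % 2))

/-- `K_n(j, k)`. -/
def Kn (a : ℝ) (n : ℕ) (j k : ℤ) : ℂ :=
  (-1 : ℂ) ^ (j + k) * innerInt a fun w => outerInt a fun z =>
    1 / (z - w) *
      (z ^ ((n : ℤ) - j) * (1 + a * w) ^ n * (w - a) ^ (n + 1)) /
      (w ^ ((n : ℤ) + 1 - k) * (1 + a * z) ^ n * (z - a) ^ (n + 1))

/-- `(𝟙 - K) g = f` for sequences on `[N, ∞)`, where `K` acts as an infinite matrix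
(the row sums being required to converge). -/
def IsResolventImage (K : ℤ → ℤ → ℂ) (N : ℤ) (f g : Set.Ici N → ℂ) : Prop :=
  ∀ j : Set.Ici N, HasSum (fun k : Set.Ici N => K j k * g k) (g j - f j)

/-- `𝟙 - K` is invertible on the sequences on `[N, ∞)`. -/
def OneSubInvertible (K : ℤ → ℤ → ℂ) (N : ℤ) : Prop :=
  ∀ f : Set.Ici N → ℂ, ∃! g : Set.Ici N → ℂ, IsResolventImage K N f g

/-- `(𝟙 - K)⁻¹_{≥ N} f`: the sequence `g` with `(𝟙 - K) g = f`, which is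
meaningful when `OneSubInvertible K N` holds. -/
def resolvent (K : ℤ → ℤ → ℂ) (N : ℤ) (f : Set.Ici N → ℂ) : Set.Ici N → ℂ :=
  Classical.epsilon fun g => IsResolventImage K N f g

/-- The terms, over `k ≥ n - ρ + 1 = 2m + 1`, of the (bilinear) pairing
`⟨(𝟙 - K_n)⁻¹ a_{-y, z₂}, b_{-x, z₁}⟩`. -/
def pairingTerm (a : ℝ) (n m : ℕ) (z₁ x z₂ y : ℤ) (k : Set.Ici (2 * (m : ℤ) + 1)) : ℂ :=
  resolvent (Kn a n) (2 * (m : ℤ) + 1) (fun j => aFun a n m (-y) z₂ j) k *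
    bFun a n m (-x) z₁ k

/-- The kernel `𝕂⁰_n(z₁, x; z₂, y)`. -/
def K0 (a : ℝ) (n m : ℕ) (z₁ x z₂ y : ℤ) : ℂ :=
  -(if z₂ < z₁ then (-1 : ℂ) ^ (x - y) * psi a z₁ z₂ x y else 0) + S a n m z₁ x z₂ y

/-- The `𝕂`-particle kernel `𝕂_{n, ρ}(z₁, x; z₂, y)` of the double Aztec diamond, `ρ = n - 2m`:
`(-1)^(x - y) 𝕂_{n, ρ} = 𝕂⁰_n - ⟨(𝟙 - K_n)⁻¹ a_{-y, z₂}, b_{-x, z₁}⟩_{≥ n - ρ + 1}`. -/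
def kKernel (a : ℝ) (n m : ℕ) (z₁ x z₂ y : ℤ) : ℂ :=
  (-1 : ℂ) ^ (x - y) *
    (K0 a n m z₁ x z₂ y - ∑' k : Set.Ici (2 * (m : ℤ) + 1), pairingTerm a n m z₁ x z₂ y k)

/-- The coordinates `z = η + 1`, `x = (η - ξ + 2m + 1) / 2` of the vertex `p = (ξ, η)`; the
division is exact, as `ξ` and `η` have opposite parities at the vertices. -/
def zCoord (p : ℤ × ℤ) : ℤ := p.2 + 1

def xCoord (m : ℕ) (p : ℤ × ℤ) : ℤ := (p.2 - p.1 + 2 * m + 1) / 2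

/-- The matrix, with rows indexed by white and columns by black vertices, with entries
`-(-1)^((w₁ - w₂ + b₁ - b₂ + 2)/4) 𝕂_{n, ρ}(b₂ + 1, (b₂ - b₁ + 2m + 1)/2;
w₂ + 1, (w₂ - w₁ + 2m + 1)/2)`. The power of `-1` is the principal one, so `(-1)^(1/2) = i`. -/
def kernelMatrix (a : ℝ) (n m : ℕ) : Matrix (whiteAD n m) (blackAD n m) ℂ :=
  Matrix.of fun w b =>
    -(-1 : ℂ) ^ (((w.1.1 - w.1.2 + b.1.1 - b.1.2 + 2 : ℤ) : ℂ) / 4) *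
      kKernel a n m (zCoord b) (xCoord m b) (zCoord w) (xCoord m w)

end DoubleAztec

end

/-! ### Contour integrals over the annulus and Laurent splittings. -/

namespace DoubleAztec

open Metric Filter Asymptotics Bornology

/-! Every double integral in the kernel is a `pairing` of two functions F, G on an annulus around
the segment from 0 to `a`. If F = p + q is a Laurent splitting, with p holomorphic inside and q
holomorphic outside and vanishing at infinity, then the pairing equals ∮ p G; hence ⟨F, G⟩ + ⟨G, F⟩
= ∮ F G (`pairing_add_pairing`). All functions involved are, up to sign, products z^i (1 + a z)^j (1
- a/z)^k (`mono`). Each white and each black vertex carries such a function, and `Kn` is the matrix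
of pairings of two families that are biorthogonal under ∮.

Fix a black vertex. Apart from the ψ-term, the kernel is linear in the function of the white vertex
(`linKernel`). For the four neighbours of a black vertex b', the two upper functions and the two
lower ones have suitable combinations that coincide, so the linear part drops out of K_a K_a⁻¹. The
ψ-term is present only for z₂ < z₁; its jump between the two white rows around b' gives the identity
matrix (`kernel_four_term`).

Near the boundary some neighbours are missing, and the kernel has to vanish there. To the left the
white function is outer; above the top it is inner and is orthogonal to the rows of `Kn`; below the
bottom it expands in the columns of `Kn`, and the resolvent correction is made to compensate exactly
these (`pairing_add_corrTerm_eq_zero`). This gives a right inverse, which is two-sided because there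
are as many black as white vertices.

For the invertibility of 1 - K_n, only finitely many columns of `Kn` are nonzero, so an l × l block
with l = n - 2m has to be injective. A null vector is encoded in a polynomial; division with
remainder turns the equations into a Toeplitz system, whose Gram form is a sum over 0, …, n + d with
positive weights, hence definite (`eq_zero_of_taylor_coeff_eq_zero`). -/

theorem circleIntegral_eq_zero_of_isBigO {f : ℂ → ℂ} {c : ℂ} {r R : ℝ} (hR : 0 < R) (hrR : r < R)
    (hf : DifferentiableOn ℂ f (closedBall c r)ᶜ)
    (hO : f =O[cobounded ℂ] fun z => z⁻¹ * z⁻¹) : ∮ z in C(c, R), f z = 0 := by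
  obtain ⟨C, hC0, hC⟩ := hO.exists_pos
  obtain ⟨r0, -, hr0⟩ := (hasBasis_cobounded_norm (E := ℂ)).eventually_iff.1 hC.bound
  have hd : ∀ z : ℂ, R ≤ dist z c → DifferentiableAt ℂ f z := fun z hz =>
    hf.differentiableAt (isClosed_closedBall.isOpen_compl.mem_nhds (by
      simp only [Set.mem_compl_iff, mem_closedBall, not_le]; linarith))
  -- Moving the circle out to radius `R'` does not change the integral. Its length 2πR' times the
  -- bound 4C/R'² tends to 0; the factor 4 comes from ‖z‖ ≥ R'/2, valid once R' ≥ 2‖c‖.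
  have hbound : ∀ᶠ R' : ℝ in atTop,
      ‖∮ z in C(c, R), f z‖ ≤ 8 * Real.pi * C * R'⁻¹ := by
    filter_upwards [eventually_ge_atTop R, eventually_ge_atTop (2 * ‖c‖),
      eventually_ge_atTop (2 * r0)] with R' h1 h2 h3
    have hR' : 0 < R' := hR.trans_le h1
    rw [← Complex.circleIntegral_eq_of_differentiable_on_annulus_off_countable hR h1
      Set.countable_empty
      (fun z hz => (hd z (by simpa using hz.2)).continuousAt.continuousWithinAt)
      (fun z hz => hd z (le_of_lt (by simpa using hz.1.2)))]
    have key : ∀ z ∈ sphere c R', ‖f z‖ ≤ 4 * C / R' ^ 2 := by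
      intro z hz
      have hz' : ‖z - c‖ = R' := by simpa [dist_eq_norm] using hz
      have h4 : R' / 2 ≤ ‖z‖ := by
        have := norm_sub_le z c
        linarith
      refine (hr0 (show r0 ≤ ‖z‖ by linarith)).trans ?_
      rw [← mul_inv, norm_inv, norm_mul, ← div_eq_mul_inv]
      rw [div_le_div_iff₀ (by nlinarith) (by positivity)]
      nlinarith [mul_le_mul h4 h4 (by positivity) (by positivity)]
    refine (circleIntegral.norm_integral_le_of_norm_le_const hR'.le key).trans (le_of_eq ?_)
    field_simp
    ring
  have hlim : Tendsto (fun R' : ℝ => 8 * Real.pi * C * R'⁻¹) atTop (nhds 0) := by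
    simpa using tendsto_inv_atTop_zero.const_mul (8 * Real.pi * C)
  exact norm_le_zero_iff.1 (ge_of_tendsto hlim hbound)

theorem inv_sub_isBigO (u : ℂ) : (fun v : ℂ => (v - u)⁻¹) =O[cobounded ℂ] fun v => v⁻¹ := by
  refine IsBigO.of_bound 2 ?_
  refine (hasBasis_cobounded_norm (E := ℂ)).eventually_iff.2 ⟨2 * ‖u‖ + 1, trivial, fun v hv => ?_⟩
  have hv' : 2 * ‖u‖ + 1 ≤ ‖v‖ := hv
  have h0 := norm_nonneg u
  have h1 := norm_sub_norm_le v u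
  rw [norm_inv, norm_inv, ← div_eq_mul_inv, inv_eq_one_div,
    div_le_div_iff₀ (by linarith) (by linarith)]
  linarith

/-- The annulus between the disc spanned by `0, a` and the circle through `-1/a`. -/
def ann (a : ℝ) : Set ℂ := {z | a / 2 < ‖z - a / 2‖ ∧ ‖z - a / 2‖ < a / 2 + 1 / a}

/-- Holomorphic in the disc bounded by the circle through `-1/a`. -/
def InnerHol (a : ℝ) (f : ℂ → ℂ) : Prop :=
  DifferentiableOn ℂ f (ball ((a : ℂ) / 2) (a / 2 + 1 / a))

/-- Holomorphic outside the disc spanned by `0, a`, and vanishing at infinity. -/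
def OuterHol (a : ℝ) (f : ℂ → ℂ) : Prop :=
  DifferentiableOn ℂ f (closedBall ((a : ℂ) / 2) (a / 2))ᶜ ∧ f =O[cobounded ℂ] fun z => z⁻¹

/-- `F = p + q` is a Laurent splitting on the annulus. -/
structure Splits (a : ℝ) (F p q : ℂ → ℂ) : Prop where
  inner : InnerHol a p
  outer : OuterHol a q
  eq : ∀ z ∈ ann a, F z = p z + q z

/-- Functions with a Laurent splitting. -/
def HasSplit (a : ℝ) (F : ℂ → ℂ) : Prop := ∃ p q, Splits a F p q

variable {a : ℝ}

theorem ann_subset_ball : ann a ⊆ ball ((a : ℂ) / 2) (a / 2 + 1 / a) := fun z hz => by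
  simpa [dist_eq_norm] using hz.2

theorem ann_subset_compl : ann a ⊆ (closedBall ((a : ℂ) / 2) (a / 2))ᶜ := fun z hz => by
  simpa [dist_eq_norm] using hz.1

theorem InnerHol.continuousOn {f : ℂ → ℂ} (hf : InnerHol a f) : ContinuousOn f (ann a) :=
  (DifferentiableOn.continuousOn hf).mono ann_subset_ball

theorem OuterHol.continuousOn {f : ℂ → ℂ} (hf : OuterHol a f) : ContinuousOn f (ann a) :=
  hf.1.continuousOn.mono ann_subset_compl

theorem HasSplit.continuousOn {F : ℂ → ℂ} (hF : HasSplit a F) : ContinuousOn F (ann a) := by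
  obtain ⟨p, q, h⟩ := hF
  exact (h.inner.continuousOn.add h.outer.continuousOn).congr h.eq

theorem mem_ann_of_mem_innerCircle (ha : 0 < a) {z : ℂ}
    (hz : z ∈ sphere ((a : ℂ) / 2) (a / 2 + 1 / (3 * a))) : z ∈ ann a := by
  have hz' : ‖z - a / 2‖ = a / 2 + 1 / (3 * a) := by simpa [dist_eq_norm] using hz
  have h1 : 1 / (3 * a) = (1 / a) / 3 := by field_simp
  have h2 : 0 < 1 / a := by positivity
  constructor <;> rw [hz', h1] <;> linarith

theorem mem_ann_of_mem_outerCircle (ha : 0 < a) {z : ℂ}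
    (hz : z ∈ sphere ((a : ℂ) / 2) (a / 2 + 2 / (3 * a))) : z ∈ ann a := by
  have hz' : ‖z - a / 2‖ = a / 2 + 2 / (3 * a) := by simpa [dist_eq_norm] using hz
  have h1 : 2 / (3 * a) = (1 / a) * (2 / 3) := by field_simp
  have h2 : 0 < 1 / a := by positivity
  constructor <;> rw [hz', h1] <;> linarith

theorem innerRadius_nonneg (ha : 0 < a) : 0 ≤ a / 2 + 1 / (3 * a) := by positivity
theorem outerRadius_nonneg (ha : 0 < a) : 0 ≤ a / 2 + 2 / (3 * a) := by positivity

theorem innerInt_congr (ha : 0 < a) {f g : ℂ → ℂ} (h : ∀ z ∈ ann a, f z = g z) :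
    innerInt a f = innerInt a g := by
  unfold innerInt
  rw [circleIntegral.integral_congr (innerRadius_nonneg ha)
    fun z hz => h z (mem_ann_of_mem_innerCircle ha hz)]

theorem outerInt_congr (ha : 0 < a) {f g : ℂ → ℂ} (h : ∀ z ∈ ann a, f z = g z) :
    outerInt a f = outerInt a g := by
  unfold outerInt
  rw [circleIntegral.integral_congr (outerRadius_nonneg ha)
    fun z hz => h z (mem_ann_of_mem_outerCircle ha hz)]

theorem circleIntegrable_inner (ha : 0 < a) {f : ℂ → ℂ} (hf : ContinuousOn f (ann a)) :
    CircleIntegrable f ((a : ℂ) / 2) (a / 2 + 1 / (3 * a)) :=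
  (hf.mono fun _ hz => mem_ann_of_mem_innerCircle ha hz).circleIntegrable (innerRadius_nonneg ha)

theorem innerInt_add (ha : 0 < a) {f g : ℂ → ℂ} (hf : ContinuousOn f (ann a))
    (hg : ContinuousOn g (ann a)) :
    innerInt a (fun z => f z + g z) = innerInt a f + innerInt a g := by
  unfold innerInt
  rw [circleIntegral.integral_add (circleIntegrable_inner ha hf) (circleIntegrable_inner ha hg),
    mul_add]

theorem innerInt_const_mul (k : ℂ) (f : ℂ → ℂ) :
    innerInt a (fun z => k * f z) = k * innerInt a f := by
  unfold innerInt
  rw [circleIntegral.integral_const_mul]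
  ring

theorem innerInt_inner (ha : 0 < a) {f : ℂ → ℂ} (hf : InnerHol a f) : innerInt a f = 0 := by
  unfold innerInt
  have hsub : closedBall ((a : ℂ) / 2) (a / 2 + 1 / (3 * a)) ⊆
      ball ((a : ℂ) / 2) (a / 2 + 1 / a) := by
    refine closedBall_subset_ball ?_
    have h1 : 1 / (3 * a) = (1 / a) / 3 := by field_simp
    have h2 : 0 < 1 / a := by positivity
    linarith
  rw [Complex.circleIntegral_eq_zero_of_differentiable_on_off_countable (innerRadius_nonneg ha)
    Set.countable_empty (DifferentiableOn.continuousOn (hf.mono hsub))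
    (fun z hz => DifferentiableOn.differentiableAt hf
      (isOpen_ball.mem_nhds (hsub (ball_subset_closedBall hz.1)))), mul_zero]

theorem innerInt_outer (ha : 0 < a) {f : ℂ → ℂ}
    (hf : DifferentiableOn ℂ f (closedBall ((a : ℂ) / 2) (a / 2))ᶜ)
    (hO : f =O[cobounded ℂ] fun z => z⁻¹ * z⁻¹) : innerInt a f = 0 := by
  unfold innerInt
  have h2 : 0 < 1 / (3 * a) := by positivity
  rw [circleIntegral_eq_zero_of_isBigO (by positivity) (by linarith) hf hO, mul_zero]

/-! ### Double contour integrals as a pairing. -/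

theorem outerInt_cauchy (ha : 0 < a) {F p q : ℂ → ℂ} (h : Splits a F p q) {u : ℂ}
    (hu : u ∈ sphere ((a : ℂ) / 2) (a / 2 + 1 / (3 * a))) :
    outerInt a (fun v => (v - u)⁻¹ * F v) = p u := by
  have hu' : ‖u - a / 2‖ = a / 2 + 1 / (3 * a) := by simpa [dist_eq_norm] using hu
  have h1 : 2 / (3 * a) = (1 / a) * (2 / 3) := by field_simp
  have h1' : 1 / (3 * a) = (1 / a) * (1 / 3) := by field_simp
  have h2 : 0 < 1 / a := by positivity
  have hlt : a / 2 + 1 / (3 * a) < a / 2 + 2 / (3 * a) := by rw [h1, h1']; linarith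
  have hne : ∀ v ∈ sphere ((a : ℂ) / 2) (a / 2 + 2 / (3 * a)), v - u ≠ 0 := by
    intro v hv h0
    have hv' : ‖v - a / 2‖ = a / 2 + 2 / (3 * a) := by simpa [dist_eq_norm] using hv
    rw [sub_eq_zero.1 h0, hu'] at hv'
    linarith
  have hsub : closedBall ((a : ℂ) / 2) (a / 2 + 2 / (3 * a)) ⊆
      ball ((a : ℂ) / 2) (a / 2 + 1 / a) := by
    refine closedBall_subset_ball ?_
    linarith
  have hinv : ContinuousOn (fun v : ℂ => (v - u)⁻¹)
      (sphere ((a : ℂ) / 2) (a / 2 + 2 / (3 * a))) :=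
    ContinuousOn.inv₀ (by fun_prop) hne
  have hs : sphere ((a : ℂ) / 2) (a / 2 + 2 / (3 * a)) ⊆ ann a :=
    fun _ hz => mem_ann_of_mem_outerCircle ha hz
  have hp : ∮ v in C((a : ℂ) / 2, a / 2 + 2 / (3 * a)), (v - u)⁻¹ * p v
      = (2 * Real.pi * I) * p u := by
    simpa using DifferentiableOn.circleIntegral_sub_inv_smul
      (DifferentiableOn.mono h.inner hsub)
      (show u ∈ ball ((a : ℂ) / 2) (a / 2 + 2 / (3 * a)) by
        simpa [dist_eq_norm, hu'] using hlt)
  -- The outer part has no singularity outside the `u`-circle, and division by v - u improves its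
  -- decay to v⁻², so the contour can be pushed to infinity.
  have hq : ∮ v in C((a : ℂ) / 2, a / 2 + 2 / (3 * a)), (v - u)⁻¹ * q v = 0 := by
    refine circleIntegral_eq_zero_of_isBigO (r := a / 2 + 1 / (3 * a)) (by positivity) hlt ?_
      ((inv_sub_isBigO u).mul h.outer.2)
    refine DifferentiableOn.mul (DifferentiableOn.inv (by fun_prop) ?_)
      (h.outer.1.mono ?_)
    · intro v hv h0
      rw [sub_eq_zero.1 h0] at hv
      exact hv (sphere_subset_closedBall hu)
    · refine Set.compl_subset_compl.2 (closedBall_subset_closedBall ?_)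
      have : 0 < 1 / (3 * a) := by positivity
      linarith
  unfold outerInt
  rw [circleIntegral.integral_congr (outerRadius_nonneg ha)
    (g := fun v => (v - u)⁻¹ * p v + (v - u)⁻¹ * q v)
    (fun v hv => by simp only [h.eq v (hs hv)]; ring),
    circleIntegral.integral_add
      ((hinv.fun_mul (h.inner.continuousOn.mono hs)).circleIntegrable (outerRadius_nonneg ha))
      ((hinv.fun_mul (h.outer.continuousOn.mono hs)).circleIntegrable (outerRadius_nonneg ha)),
    hp, hq, add_zero, inv_mul_cancel_left₀ (by simp [Real.pi_ne_zero])]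

/-- The double contour integral `∮ du ∮ dv F(v) G(u) / (v - u)`, with `u` on the inner circle. -/
noncomputable def pairing (a : ℝ) (F G : ℂ → ℂ) : ℂ :=
  innerInt a fun u => outerInt a fun v => F v * G u / (v - u)

/-- By Cauchy's formula the `v`-integral projects F onto its inner part, evaluated at u. -/
theorem Splits.pairing_eq (ha : 0 < a) {F p q : ℂ → ℂ} (h : Splits a F p q) (G : ℂ → ℂ) :
    pairing a F G = innerInt a fun u => p u * G u := by
  unfold pairing
  conv_lhs => unfold innerInt
  conv_rhs => unfold innerInt
  rw [circleIntegral.integral_congr (innerRadius_nonneg ha) fun u hu => ?_]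
  have : (fun v => F v * G u / (v - u)) = fun v => G u * ((v - u)⁻¹ * F v) := by
    funext v; rw [div_eq_mul_inv]; ring
  simp only [this]
  have h3 : outerInt a (fun v => G u * ((v - u)⁻¹ * F v))
      = G u * outerInt a (fun v => (v - u)⁻¹ * F v) := by
    unfold outerInt
    rw [circleIntegral.integral_const_mul]
    ring
  rw [h3, outerInt_cauchy ha h hu, mul_comm]

theorem pairing_congr (ha : 0 < a) {F F' G G' : ℂ → ℂ} (hF : ∀ z ∈ ann a, F z = F' z)
    (hG : ∀ z ∈ ann a, G z = G' z) : pairing a F G = pairing a F' G' :=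
  innerInt_congr ha fun u hu => outerInt_congr ha fun v hv => by rw [hF v hv, hG u hu]

/-- On the annulus, the function extends holomorphically inwards. -/
def IsInner (a : ℝ) (F : ℂ → ℂ) : Prop := ∃ p, InnerHol a p ∧ ∀ z ∈ ann a, F z = p z

/-- On the annulus, the function extends holomorphically outwards and vanishes at infinity. -/
def IsOuter (a : ℝ) (F : ℂ → ℂ) : Prop := ∃ q, OuterHol a q ∧ ∀ z ∈ ann a, F z = q z

theorem InnerHol.zero : InnerHol a fun _ => 0 := differentiableOn_const 0

theorem OuterHol.zero : OuterHol a fun _ => 0 := ⟨differentiableOn_const 0, isBigO_zero _ _⟩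

theorem IsInner.hasSplit {F : ℂ → ℂ} (h : IsInner a F) : HasSplit a F := by
  obtain ⟨p, hp, h⟩ := h
  exact ⟨p, _, hp, OuterHol.zero, by simpa using h⟩

theorem IsOuter.hasSplit {F : ℂ → ℂ} (h : IsOuter a F) : HasSplit a F := by
  obtain ⟨p, hp, h⟩ := h
  exact ⟨_, p, InnerHol.zero, hp, by simpa using h⟩

theorem IsInner.mul {F G : ℂ → ℂ} (hF : IsInner a F) (hG : IsInner a G) :
    IsInner a fun z => F z * G z := by
  obtain ⟨p, hp, h⟩ := hF
  obtain ⟨q, hq, h'⟩ := hG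
  exact ⟨fun z => p z * q z, DifferentiableOn.mul hp hq, fun z hz => by simp only [h z hz, h' z hz]⟩

theorem innerInt_isInner (ha : 0 < a) {F : ℂ → ℂ} (h : IsInner a F) : innerInt a F = 0 := by
  obtain ⟨p, hp, h⟩ := h
  rw [innerInt_congr ha h, innerInt_inner ha hp]

theorem pairing_right_inner (ha : 0 < a) {F G : ℂ → ℂ} (hF : HasSplit a F) (hG : IsInner a G) :
    pairing a F G = 0 := by
  obtain ⟨p, q, h⟩ := hF
  rw [h.pairing_eq ha]
  exact innerInt_isInner ha (IsInner.mul ⟨p, h.inner, fun _ _ => rfl⟩ hG)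

theorem pairing_left_outer (ha : 0 < a) {F : ℂ → ℂ} (hF : IsOuter a F) (G : ℂ → ℂ) :
    pairing a F G = 0 := by
  obtain ⟨q, hq, h⟩ := hF
  rw [Splits.pairing_eq ha (p := fun _ => 0) ⟨InnerHol.zero, hq, by simpa using h⟩]
  simp [innerInt, circleIntegral]

/-- Since p G + p' F = F G + p p' - q q', it suffices that ∮ p p' = 0 by Cauchy's theorem and ∮ q q'
= 0 by the decay z⁻². Exchanging the two contours thus costs the residue at u = v. -/
theorem pairing_add_pairing (ha : 0 < a) {F G : ℂ → ℂ} (hF : HasSplit a F) (hG : HasSplit a G) :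
    pairing a F G + pairing a G F = innerInt a fun z => F z * G z := by
  have hFc := hF.continuousOn
  have hGc := hG.continuousOn
  obtain ⟨p, q, h⟩ := hF
  obtain ⟨p', q', h'⟩ := hG
  have e1 : innerInt a (fun u => p u * p' u) = 0 :=
    innerInt_inner ha (DifferentiableOn.mul h.inner h'.inner)
  have e2 : innerInt a (fun u => q u * q' u) = 0 :=
    innerInt_outer ha (h.outer.1.mul h'.outer.1) (h.outer.2.mul h'.outer.2)
  have c1 := h.inner.continuousOn
  have c2 := h.outer.continuousOn
  have c3 := h'.inner.continuousOn
  have c4 := h'.outer.continuousOn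
  rw [h.pairing_eq ha, h'.pairing_eq ha, ← innerInt_add ha (c1.fun_mul hGc) (c3.fun_mul hFc)]
  rw [innerInt_congr ha (g := fun z => (F z * G z + p z * p' z) + (-1) * (q z * q' z)),
    innerInt_add ha, innerInt_add ha, innerInt_const_mul, e1, e2]
  · ring
  · exact hFc.mul hGc
  · exact c1.mul c3
  · exact (hFc.mul hGc).add (c1.mul c3)
  · exact continuousOn_const.mul (c2.mul c4)
  · intro z hz
    rw [h.eq z hz, h'.eq z hz]
    ring

theorem pairing_right_add (ha : 0 < a) {F G G' : ℂ → ℂ} (hF : HasSplit a F)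
    (hG : ContinuousOn G (ann a)) (hG' : ContinuousOn G' (ann a)) (c : ℂ) :
    pairing a F (fun z => c * G z + G' z) = c * pairing a F G + pairing a F G' := by
  obtain ⟨p, q, h⟩ := hF
  have c1 := h.inner.continuousOn
  rw [h.pairing_eq ha, h.pairing_eq ha, h.pairing_eq ha,
    ← innerInt_const_mul, ← innerInt_add ha (continuousOn_const.fun_mul (c1.fun_mul hG)) (c1.fun_mul hG')]
  congr 1
  funext z
  ring

theorem HasSplit.mul_add {F F' : ℂ → ℂ} (hF : HasSplit a F) (hF' : HasSplit a F') (c : ℂ) :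
    HasSplit a fun z => c * F z + F' z := by
  obtain ⟨p, q, h⟩ := hF
  obtain ⟨p', q', h'⟩ := hF'
  refine ⟨fun z => c * p z + p' z, fun z => c * q z + q' z,
    (DifferentiableOn.const_mul h.inner c).add h'.inner,
    ⟨(h.outer.1.const_mul c).add h'.outer.1,
    (h.outer.2.const_mul_left c).add h'.outer.2⟩, fun z hz => ?_⟩
  rw [h.eq z hz, h'.eq z hz]
  ring

/-- `pairing_add_pairing` transfers linearity from the second slot, where no splitting of the
varying function is needed. -/
theorem pairing_left_add (ha : 0 < a) {F F' G : ℂ → ℂ} (hF : HasSplit a F) (hF' : HasSplit a F')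
    (hG : HasSplit a G) (c : ℂ) :
    pairing a (fun z => c * F z + F' z) G = c * pairing a F G + pairing a F' G := by
  have h1 := pairing_add_pairing ha (hF.mul_add hF' c) hG
  have h2 := pairing_add_pairing ha hF hG
  have h3 := pairing_add_pairing ha hF' hG
  rw [pairing_right_add ha hG hF.continuousOn hF'.continuousOn] at h1
  have h4 : innerInt a (fun z => (c * F z + F' z) * G z)
      = c * innerInt a (fun z => F z * G z) + innerInt a (fun z => F' z * G z) := by
    rw [← innerInt_const_mul, ← innerInt_add ha
      (continuousOn_const.fun_mul (hF.continuousOn.fun_mul hG.continuousOn))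
      (hF'.continuousOn.fun_mul hG.continuousOn)]
    congr 1
    funext z
    ring
  rw [h4] at h1
  linear_combination h1 - c * h2 - h3

/-! ### The functions z^i (1 + a z)^j (1 - a/z)^k. -/

theorem zero_mem_closedBall (ha : 0 < a) : (0 : ℂ) ∈ closedBall ((a : ℂ) / 2) (a / 2) := by
  simp [dist_eq_norm, abs_of_pos ha]

theorem self_mem_closedBall (ha : 0 < a) : (a : ℂ) ∈ closedBall ((a : ℂ) / 2) (a / 2) := by
  rw [mem_closedBall, dist_eq_norm, show (a : ℂ) - a / 2 = a / 2 by ring]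
  simp [abs_of_pos ha]

theorem ne_of_mem_closedBall {z w : ℂ} (hz : z ∈ ann a)
    (hw : w ∈ closedBall ((a : ℂ) / 2) (a / 2)) : z ≠ w := by
  rintro rfl
  exact ann_subset_compl hz hw

theorem ann_ne_zero (ha : 0 < a) {z : ℂ} (hz : z ∈ ann a) : z ≠ 0 :=
  ne_of_mem_closedBall hz (zero_mem_closedBall ha)

theorem ann_sub_ne_zero (ha : 0 < a) {z : ℂ} (hz : z ∈ ann a) : z - a ≠ 0 :=
  sub_ne_zero.2 (ne_of_mem_closedBall hz (self_mem_closedBall ha))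

theorem one_add_ne_zero (ha : 0 < a) {z : ℂ} (hz : z ∈ ball ((a : ℂ) / 2) (a / 2 + 1 / a)) :
    1 + a * z ≠ 0 := by
  intro h
  have ha' : (a : ℂ) ≠ 0 := by exact_mod_cast ha.ne'
  have : z = -(1 / a) := by
    field_simp
    linear_combination h
  rw [mem_ball, dist_eq_norm, this, show -(1 / (a : ℂ)) - a / 2 = -((a / 2 + 1 / a : ℝ) : ℂ) by
    push_cast; ring, norm_neg, Complex.norm_real, Real.norm_of_nonneg (by positivity)] at hz
  exact lt_irrefl _ hz

theorem ann_one_add_ne_zero (ha : 0 < a) {z : ℂ} (hz : z ∈ ann a) : 1 + a * z ≠ 0 :=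
  one_add_ne_zero ha (ann_subset_ball hz)

theorem ann_one_sub_ne_zero (ha : 0 < a) {z : ℂ} (hz : z ∈ ann a) : 1 - a / z ≠ 0 := by
  have h0 := ann_ne_zero ha hz
  have := ann_sub_ne_zero ha hz
  rw [one_sub_div h0]
  exact div_ne_zero this h0

/-- The function `z ^ i * (1 + a z) ^ j * (1 - a / z) ^ k`. -/
noncomputable def mono (a : ℝ) (i j k : ℤ) (z : ℂ) : ℂ :=
  z ^ i * (1 + a * z) ^ j * (1 - a / z) ^ k

theorem mono_mul_mono (ha : 0 < a) {z : ℂ} (hz : z ∈ ann a) (i j k i' j' k' : ℤ) :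
    mono a i j k z * mono a i' j' k' z = mono a (i + i') (j + j') (k + k') z := by
  unfold mono
  rw [zpow_add₀ (ann_ne_zero ha hz), zpow_add₀ (ann_one_add_ne_zero ha hz),
    zpow_add₀ (ann_one_sub_ne_zero ha hz)]
  ring

theorem mono_eq (ha : 0 < a) {z : ℂ} (hz : z ∈ ann a) (i j k : ℤ) :
    mono a i j k z = z ^ (i - k) * (z - a) ^ k * (1 + a * z) ^ j := by
  unfold mono
  rw [one_sub_div (ann_ne_zero ha hz), div_zpow, zpow_sub₀ (ann_ne_zero ha hz)]
  ring

theorem innerHol_one_add_zpow (ha : 0 < a) (j : ℤ) : InnerHol a fun z => (1 + a * z) ^ j := by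
  intro z hz
  refine DifferentiableWithinAt.zpow (by fun_prop) (Or.inl (one_add_ne_zero ha hz))

theorem InnerHol.mul {f g : ℂ → ℂ} (hf : InnerHol a f) (hg : InnerHol a g) :
    InnerHol a fun z => f z * g z := DifferentiableOn.fun_mul hf hg

theorem innerHol_sub_zpow (w : ℂ) {i : ℤ} (hi : 0 ≤ i) : InnerHol a fun z => (z - w) ^ i := by
  intro z _
  refine DifferentiableWithinAt.zpow (by fun_prop) (Or.inr hi)

theorem mono_isInner (ha : 0 < a) {i j k : ℤ} (hk : 0 ≤ k) (hi : k ≤ i) :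
    IsInner a (mono a i j k) := by
  have h0 := innerHol_sub_zpow (a := a) 0 (sub_nonneg.2 hi)
  simp only [sub_zero] at h0
  exact ⟨_, (h0.mul (innerHol_sub_zpow (a : ℂ) hk)).mul (innerHol_one_add_zpow ha j),
    fun z hz => mono_eq ha hz i j k⟩

/-- Write (p + q)/(z - w) = (p - p(w))/(z - w) + (p(w) + q)/(z - w): the first quotient has a
removable singularity at w, the second vanishes at infinity. -/
theorem HasSplit.inv_sub_mul (ha : 0 < a) {F : ℂ → ℂ} (hF : HasSplit a F) {w : ℂ}
    (hw : w ∈ closedBall ((a : ℂ) / 2) (a / 2)) : HasSplit a fun z => (z - w)⁻¹ * F z := by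
  obtain ⟨p, q, h⟩ := hF
  have hne : ∀ z ∈ (closedBall ((a : ℂ) / 2) (a / 2))ᶜ, z - w ≠ 0 := by
    intro z hz h0
    rw [sub_eq_zero.1 h0] at hz
    exact hz hw
  have hinv : DifferentiableOn ℂ (fun z => (z - w)⁻¹) (closedBall ((a : ℂ) / 2) (a / 2))ᶜ :=
    DifferentiableOn.inv (by fun_prop) hne
  have hbig : (fun z : ℂ => p w + q z) =O[cobounded ℂ] fun _ => (1 : ℂ) := by
    refine (isBigO_const_const _ one_ne_zero _).add (h.outer.2.trans ?_)
    exact (tendsto_inv₀_cobounded (α := ℂ)).isBigO_one ℂ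
  refine ⟨dslope p w, fun z => (z - w)⁻¹ * (p w + q z), ?_, ⟨?_, ?_⟩, ?_⟩
  · refine (Complex.differentiableOn_dslope (isOpen_ball.mem_nhds ?_)).2 h.inner
    refine closedBall_subset_ball ?_ hw
    have : 0 < 1 / a := by positivity
    linarith
  · exact hinv.fun_mul (h.outer.1.const_add _)
  · simpa using (inv_sub_isBigO w).mul hbig
  · intro z hz
    have hzw := ne_of_mem_closedBall hz hw
    rw [dslope_of_ne _ hzw, slope_def_field, h.eq z hz]
    ring

theorem HasSplit.sub_zpow_neg_mul (ha : 0 < a) {F : ℂ → ℂ} (hF : HasSplit a F) {w : ℂ}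
    (hw : w ∈ closedBall ((a : ℂ) / 2) (a / 2)) (N : ℕ) :
    HasSplit a fun z => (z - w) ^ (-(N : ℤ)) * F z := by
  induction N with
  | zero => simpa using hF
  | succ N ih =>
    convert ih.inv_sub_mul ha hw using 2 with z
    simp only [zpow_neg, zpow_natCast, pow_succ, mul_inv]
    ring

theorem HasSplit.congr {F G : ℂ → ℂ} (hF : HasSplit a F) (h : ∀ z ∈ ann a, G z = F z) :
    HasSplit a G := by
  obtain ⟨p, q, h'⟩ := hF
  exact ⟨p, q, h'.inner, h'.outer, fun z hz => (h z hz).trans (h'.eq z hz)⟩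

theorem zpow_split {z : ℂ} (hz : z ≠ 0) (i : ℤ) :
    z ^ i = z ^ (-((-i).toNat : ℤ)) * z ^ (i.toNat : ℤ) := by
  rw [← zpow_add₀ hz]
  congr 1
  omega

/-- Inside the larger disc the only possible poles are at 0 and a, so `mono` is an inner function
divided by powers of z and z - a. -/
theorem mono_hasSplit (ha : 0 < a) (i j k : ℤ) : HasSplit a (mono a i j k) := by
  have h0 := innerHol_sub_zpow (a := a) 0 (Int.natCast_nonneg (i - k).toNat)
  have h1 := innerHol_sub_zpow (a := a) (a : ℂ) (Int.natCast_nonneg k.toNat)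
  have h2 : IsInner a _ := ⟨_, (h0.mul h1).mul (innerHol_one_add_zpow ha j), fun _ _ => rfl⟩
  refine ((h2.hasSplit.sub_zpow_neg_mul ha (self_mem_closedBall ha) (-k).toNat).sub_zpow_neg_mul
    ha (zero_mem_closedBall ha) (-(i - k)).toNat).congr fun z hz => ?_
  rw [mono_eq ha hz, zpow_split (ann_ne_zero ha hz) (i - k),
    zpow_split (ann_sub_ne_zero ha hz) k]
  simp only [sub_zero]
  ring

theorem mono_differentiableOn_outer (ha : 0 < a) (i k : ℤ) {j : ℤ} (hj : 0 ≤ j) :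
    DifferentiableOn ℂ (mono a i j k) (closedBall ((a : ℂ) / 2) (a / 2))ᶜ := by
  intro z hz
  have h0 : z ≠ 0 := by
    rintro rfl
    exact hz (zero_mem_closedBall ha)
  have h1 : 1 - a / z ≠ 0 := by
    rw [one_sub_div h0]
    refine div_ne_zero (sub_ne_zero.2 ?_) h0
    rintro rfl
    exact hz (self_mem_closedBall ha)
  unfold mono
  refine ((DifferentiableWithinAt.zpow (by fun_prop) (Or.inl h0)).fun_mul
    (DifferentiableWithinAt.zpow (by fun_prop) (Or.inr hj))).fun_mul
    (DifferentiableWithinAt.zpow ?_ (Or.inl h1))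
  exact (DifferentiableWithinAt.fun_div (by fun_prop) (by fun_prop) h0).const_sub 1

theorem eventually_one_le_norm : ∀ᶠ z : ℂ in cobounded ℂ, 1 ≤ ‖z‖ :=
  (hasBasis_cobounded_norm (E := ℂ)).eventually_iff.2 ⟨1, trivial, fun _ h => h⟩

theorem mono_isBigO (i k : ℤ) {j : ℤ} (hj : 0 ≤ j) :
    mono a i j k =O[cobounded ℂ] fun z => z ^ (i + j) := by
  obtain ⟨j, rfl⟩ := Int.eq_ofNat_of_zero_le hj
  have h1 : (fun z : ℂ => 1 + a * z) =O[cobounded ℂ] fun z => z := by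
    refine IsBigO.add ?_ ((isBigO_refl _ _).const_mul_left _)
    refine IsBigO.of_bound 1 (eventually_one_le_norm.mono fun z hz => ?_)
    simpa using hz
  have h2 : (fun z : ℂ => (1 - a / z) ^ k) =O[cobounded ℂ] fun _ => (1 : ℂ) := by
    have : Tendsto (fun z : ℂ => 1 - a / z) (cobounded ℂ) (nhds 1) := by
      simpa [div_eq_mul_inv] using
        ((tendsto_inv₀_cobounded (α := ℂ)).const_mul (a : ℂ)).const_sub 1
    exact (this.zpow₀ k (Or.inl one_ne_zero)).isBigO_one ℂ
  have h3 := ((isBigO_refl (fun z : ℂ => z ^ i) (cobounded ℂ)).mul (h1.pow j)).mul h2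
  refine (h3.congr' (.of_forall fun z => ?_) ?_)
  · simp [mono]
  · filter_upwards [eventually_one_le_norm] with z hz
    have : z ≠ 0 := by
      rintro rfl
      norm_num at hz
    rw [mul_one, zpow_add₀ this]
    simp

theorem zpow_isBigO_zpow {i j : ℤ} (h : i ≤ j) :
    (fun z : ℂ => z ^ i) =O[cobounded ℂ] fun z => z ^ j := by
  refine IsBigO.of_bound 1 (eventually_one_le_norm.mono fun z hz => ?_)
  rw [norm_zpow, norm_zpow, one_mul]
  exact zpow_le_zpow_right₀ hz h

theorem mono_isOuter (ha : 0 < a) (k : ℤ) {i j : ℤ} (hj : 0 ≤ j) (hij : i + j ≤ -1) :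
    IsOuter a (mono a i j k) := by
  refine ⟨_, ⟨mono_differentiableOn_outer ha i k hj, ?_⟩, fun _ _ => rfl⟩
  simpa using (mono_isBigO i k hj).trans (zpow_isBigO_zpow hij)

theorem innerInt_mono_eq_zero (ha : 0 < a) (k : ℤ) {i j : ℤ} (hj : 0 ≤ j) (hij : i + j ≤ -2) :
    innerInt a (mono a i j k) = 0 := by
  refine innerInt_outer ha (mono_differentiableOn_outer ha i k hj) ?_
  convert (mono_isBigO i k hj).trans (zpow_isBigO_zpow hij) using 2 with z
  rw [show (-2 : ℤ) = -(2 : ℕ) by norm_num, zpow_neg, zpow_natCast, pow_two, mul_inv]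

theorem innerInt_sub_zpow (ha : 0 < a) {w : ℂ} (hw : w ∈ closedBall ((a : ℂ) / 2) (a / 2))
    (i : ℤ) : innerInt a (fun z => (z - w) ^ i) = if i = -1 then 1 else 0 := by
  unfold innerInt
  split_ifs with h
  · subst h
    have hw' : w ∈ ball ((a : ℂ) / 2) (a / 2 + 1 / (3 * a)) := by
      refine closedBall_subset_ball ?_ hw
      have : 0 < 1 / (3 * a) := by positivity
      linarith
    simp only [zpow_neg_one]
    rw [circleIntegral.integral_sub_inv_of_mem_ball hw', inv_mul_cancel₀]
    simp [Real.pi_ne_zero]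
  · rw [circleIntegral.integral_sub_zpow_of_ne h, mul_zero]

theorem innerInt_mono_zero_zero (ha : 0 < a) (i : ℤ) :
    innerInt a (mono a i 0 0) = if i = -1 then 1 else 0 := by
  rw [← innerInt_sub_zpow ha (zero_mem_closedBall ha) i]
  congr 1
  funext z
  simp [mono]

end DoubleAztec

/-! ### The ingredients of the kernel as pairings. -/

namespace DoubleAztec

variable {a : ℝ}

/-- The function of the contour variable attached to the white vertex with coordinates
`z = 2 s + 1` and `y`. -/
noncomputable def whiteFun (a : ℝ) (n m : ℕ) (y s : ℤ) : ℂ → ℂ := mono a (m - y) s (n - s)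

/-- The function of the contour variable attached to the black vertex with coordinates
`z = 2 r` and `x`. -/
noncomputable def blackFun (a : ℝ) (n m : ℕ) (x r : ℤ) : ℂ → ℂ :=
  mono a (x - m - 1) (-r) (r - n - 1)

/-- The functions indexing the rows of `Kn`. -/
noncomputable def rowFun (a : ℝ) (n : ℕ) (j : ℤ) (z : ℂ) : ℂ :=
  (-1) ^ j * mono a (-j - 1) (-n) (-(n + 1)) z

/-- The functions indexing the columns of `Kn`. -/
noncomputable def colFun (a : ℝ) (n : ℕ) (k : ℤ) (z : ℂ) : ℂ :=
  (-1) ^ k * mono a k n (n + 1) z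

theorem HasSplit.const_mul {F : ℂ → ℂ} (hF : HasSplit a F) (c : ℂ) :
    HasSplit a fun z => c * F z := by
  simpa using hF.mul_add (IsInner.hasSplit ⟨_, InnerHol.zero, fun _ _ => rfl⟩) c

theorem IsInner.const_mul {F : ℂ → ℂ} (hF : IsInner a F) (c : ℂ) :
    IsInner a fun z => c * F z :=
  IsInner.mul ⟨fun _ => c, differentiableOn_const c, fun _ _ => rfl⟩ hF

theorem whiteFun_hasSplit (ha : 0 < a) (n m : ℕ) (y s : ℤ) : HasSplit a (whiteFun a n m y s) :=
  mono_hasSplit ha _ _ _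

theorem blackFun_hasSplit (ha : 0 < a) (n m : ℕ) (x r : ℤ) : HasSplit a (blackFun a n m x r) :=
  mono_hasSplit ha _ _ _

theorem rowFun_hasSplit (ha : 0 < a) (n : ℕ) (j : ℤ) : HasSplit a (rowFun a n j) :=
  (mono_hasSplit ha _ _ _).const_mul _

theorem colFun_hasSplit (ha : 0 < a) (n : ℕ) (k : ℤ) : HasSplit a (colFun a n k) :=
  (mono_hasSplit ha _ _ _).const_mul _

theorem outerInt_const_mul (k : ℂ) (f : ℂ → ℂ) :
    outerInt a (fun z => k * f z) = k * outerInt a f := by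
  unfold outerInt
  rw [circleIntegral.integral_const_mul]
  ring

theorem pairing_const_mul (c d : ℂ) (F G : ℂ → ℂ) :
    pairing a (fun z => c * F z) (fun z => d * G z) = c * d * pairing a F G := by
  unfold pairing
  rw [← innerInt_const_mul]
  congr 1
  funext u
  rw [← outerInt_const_mul]
  congr 1
  funext v
  ring

theorem neg_one_zpow_mul_self (k : ℤ) : (-1 : ℂ) ^ k * (-1) ^ k = 1 := by
  rw [← mul_zpow]
  simp

theorem neg_one_zpow_sub (x y : ℤ) : (-1 : ℂ) ^ (x - y) = (-1) ^ x * (-1) ^ y := by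
  rw [zpow_sub₀ (by norm_num), div_eq_iff (zpow_ne_zero _ (by norm_num)), mul_assoc,
    neg_one_zpow_mul_self, mul_one]

theorem Kn_eq (ha : 0 < a) (n : ℕ) (j k : ℤ) :
    Kn a n j k = pairing a (rowFun a n j) (colFun a n k) := by
  unfold rowFun colFun
  rw [pairing_const_mul, ← zpow_add₀ (by norm_num)]
  unfold Kn pairing
  congr 1
  refine innerInt_congr ha fun w hw => outerInt_congr ha fun z hz => ?_
  have hw0 := ann_ne_zero ha hw
  have hz0 := ann_ne_zero ha hz
  rw [mono_eq ha hz, mono_eq ha hw]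
  have e1 : z ^ (-j - 1 - -((n : ℤ) + 1)) = z ^ ((n : ℤ) - j) := by congr 1; ring
  have e2 : w ^ (k - ((n : ℤ) + 1)) = (w ^ ((n : ℤ) + 1 - k))⁻¹ := by
    rw [← zpow_neg]; congr 1; ring
  have e3 : ∀ t : ℂ, t ^ ((n : ℤ) + 1) = t ^ (n + 1) := fun t => by norm_cast
  rw [e1, e2, zpow_neg, zpow_neg, e3, e3, zpow_natCast, zpow_natCast]
  generalize (z - a) ^ (n + 1) = p₁, (w - a) ^ (n + 1) = p₂, (1 + a * z) ^ n = p₃,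
    (1 + a * w) ^ n = p₄
  ring

theorem S_eq (ha : 0 < a) (n m : ℕ) (r x s y : ℤ) :
    S a n m (2 * r) x (2 * s + 1) y
      = (-1) ^ (x - y) * pairing a (blackFun a n m x r) (whiteFun a n m y s) := by
  unfold S pairing blackFun whiteFun mono
  congr 1
  rw [show (2 * s + 1) / 2 = s by omega, show (2 * s + 1) % 2 = 1 by omega,
    show 2 * r / 2 = r by omega, show 2 * r % 2 = 0 by omega]
  refine innerInt_congr ha fun u hu => outerInt_congr ha fun v hv => ?_
  rw [show (n : ℤ) - s + 1 - 1 = n - s by ring, show r - (n : ℤ) - 1 = -(n - r + 1 - 0) by ring,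
    show (m : ℤ) - y = -(y - m) by ring]
  simp only [zpow_neg]
  ring

theorem aFun_eq (ha : 0 < a) (n m : ℕ) (s y k : ℤ) :
    aFun a n m (-y) (2 * s + 1) k
      = (-1) ^ y * -pairing a (whiteFun a n m y s) (rowFun a n k) := by
  have h := pairing_const_mul (a := a) 1 ((-1) ^ k) (whiteFun a n m y s)
    (mono a (-k - 1) (-n) (-(n + 1)))
  simp only [one_mul] at h
  unfold rowFun
  rw [h, show ∀ p q t : ℂ, p * -(q * t) = (p * q) * (-1 * t) by intros; ring,
    ← zpow_add₀ (by norm_num)]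
  unfold pairing aFun whiteFun
  rw [← innerInt_const_mul (-1), show k - -y = y + k by ring,
    show (2 * s + 1) / 2 = s by omega, show (2 * s + 1) % 2 = 1 by omega]
  congr 1
  refine innerInt_congr ha fun u hu => ?_
  rw [← outerInt_const_mul]
  refine outerInt_congr ha fun v hv => ?_
  unfold mono
  rw [show (n : ℤ) - s + 1 - 1 = n - s by ring, show -k - 1 = -(k + 1) by ring,
    show (m : ℤ) - y = -y + m by ring, ← neg_sub v u, one_div, inv_neg]
  have e3 : ∀ t : ℂ, t ^ ((n : ℤ) + 1) = t ^ (n + 1) := fun t => by norm_cast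
  simp only [zpow_neg, e3, zpow_natCast]
  generalize (1 - a / u) ^ (n + 1) = p₁, (1 + a * u) ^ n = p₂
  ring

theorem bFun_eq (ha : 0 < a) (n m : ℕ) (r x k : ℤ) :
    bFun a n m (-x) (2 * r) k
      = (-1) ^ x * pairing a (colFun a n k) (blackFun a n m x r) := by
  have h := pairing_const_mul (a := a) ((-1) ^ k) 1 (mono a k n (n + 1)) (blackFun a n m x r)
  simp only [one_mul] at h
  unfold colFun
  rw [h, mul_one, ← mul_assoc, ← zpow_add₀ (by norm_num)]
  unfold pairing bFun blackFun
  rw [show k - -x = x + k by ring, show 2 * r / 2 = r by omega, show 2 * r % 2 = 0 by omega]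
  congr 1
  refine innerInt_congr ha fun u hu => outerInt_congr ha fun v hv => ?_
  unfold mono
  rw [show x - m - 1 = -(-x + m + 1) by ring, show r - (n : ℤ) - 1 = -(n - r + 1 - 0) by ring]
  have e3 : ∀ t : ℂ, t ^ ((n : ℤ) + 1) = t ^ (n + 1) := fun t => by norm_cast
  simp only [zpow_neg, e3, zpow_natCast]
  ring

theorem psi_eq (ha : 0 < a) (n m : ℕ) (r x s y : ℤ) :
    psi a (2 * r) (2 * s + 1) x y
      = innerInt a fun z => blackFun a n m x r z * whiteFun a n m y s z := by
  refine innerInt_congr ha fun z hz => ?_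
  unfold blackFun whiteFun
  rw [mono_mul_mono ha hz]
  unfold mono
  rw [show (2 * s + 1) / 2 = s by omega, show (2 * s + 1) % 2 = 1 by omega,
    show 2 * r / 2 = r by omega, show 2 * r % 2 = 0 by omega,
    show x - m - 1 + (m - y) = x - y - 1 by ring, zpow_sub_one₀ (ann_ne_zero ha hz),
    show r - n - 1 + (n - s) = -(s - r + 1 - 0) by ring, show -r + s = s - r by ring,
    zpow_neg (1 - a / z)]
  ring

theorem colFun_isInner (ha : 0 < a) {n : ℕ} {k : ℤ} (hk : (n : ℤ) + 1 ≤ k) :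
    IsInner a (colFun a n k) :=
  (mono_isInner ha (by omega) hk).const_mul _

/-- From index n + 1 on, the column functions have no pole at 0 or a, so `Kn` has finitely many
nonzero columns on a half-line. -/
theorem Kn_eq_zero (ha : 0 < a) {n : ℕ} (j : ℤ) {k : ℤ} (hk : (n : ℤ) + 1 ≤ k) :
    Kn a n j k = 0 := by
  rw [Kn_eq ha]
  exact pairing_right_inner ha (rowFun_hasSplit ha n j) (colFun_isInner ha hk)

/-- All factors but a power of z cancel. Together with `pairing_add_pairing` this makes ⟨col k, row
j⟩ the (j, k) entry of 1 - K_n. -/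
theorem innerInt_rowFun_colFun (ha : 0 < a) (n : ℕ) (j k : ℤ) :
    innerInt a (fun z => rowFun a n j z * colFun a n k z) = if j = k then 1 else 0 := by
  have h : ∀ z ∈ ann a, rowFun a n j z * colFun a n k z
      = ((-1) ^ j * (-1) ^ k) * mono a (k - j - 1) 0 0 z := by
    intro z hz
    unfold rowFun colFun
    rw [show ∀ p q t w : ℂ, p * q * (t * w) = p * t * (q * w) by intros; ring,
      mono_mul_mono ha hz]
    congr 2 <;> ring
  rw [innerInt_congr ha h, innerInt_const_mul, innerInt_mono_zero_zero ha]
  split_ifs with h1 h2 h2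
  · rw [h2, neg_one_zpow_mul_self, one_mul]
  · omega
  · omega
  · simp

/-- The column function is inner, so the pairing equals ∮ col · black, and for large k this product
is inner too. -/
theorem pairing_colFun_blackFun_eq_zero (ha : 0 < a) {n m : ℕ} {x r k : ℤ} (h0 : 0 ≤ r)
    (h1 : (n : ℤ) + 1 ≤ k) (h2 : r ≤ k + x - m - 1) :
    pairing a (colFun a n k) (blackFun a n m x r) = 0 := by
  have h := pairing_add_pairing ha (colFun_hasSplit ha n k) (blackFun_hasSplit ha n m x r)
  rw [pairing_right_inner ha (blackFun_hasSplit ha n m x r) (colFun_isInner ha h1), add_zero] at h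
  rw [h]
  obtain ⟨p, hp, hpe⟩ : IsInner a fun z =>
      (-1) ^ k * mono a (k + x - m - 1) ((n : ℤ) - r) r z :=
    (mono_isInner ha h0 h2).const_mul _
  refine innerInt_isInner ha ⟨p, hp, fun z hz => ?_⟩
  rw [← hpe z hz]
  unfold colFun blackFun
  beta_reduce
  rw [mul_assoc, mono_mul_mono ha hz]
  congr 2 <;> ring

/-! ### The resolvent and the correction term. -/

theorem resolvent_spec {K : ℤ → ℤ → ℂ} {N : ℤ} (hK : OneSubInvertible K N)
    (f : Set.Ici N → ℂ) : IsResolventImage K N f (resolvent K N f) :=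
  Classical.epsilon_spec (hK f).exists

theorem IsResolventImage.eq_resolvent {K : ℤ → ℤ → ℂ} {N : ℤ} (hK : OneSubInvertible K N)
    {f g : Set.Ici N → ℂ} (h : IsResolventImage K N f g) : resolvent K N f = g :=
  (hK f).unique (resolvent_spec hK f) h

/-- `resolvent` is a mere choice; it is linear because solutions are unique. -/
theorem resolvent_mul_add {K : ℤ → ℤ → ℂ} {N : ℤ} (hK : OneSubInvertible K N)
    (f f' : Set.Ici N → ℂ) (c : ℂ) :
    resolvent K N (fun j => c * f j + f' j)
      = fun j => c * resolvent K N f j + resolvent K N f' j := by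
  refine IsResolventImage.eq_resolvent hK fun j => ?_
  have h := ((resolvent_spec hK f j).mul_left c).add (resolvent_spec hK f' j)
  rw [show c * resolvent K N f j + resolvent K N f' j - (c * f j + f' j)
      = c * (resolvent K N f j - f j) + (resolvent K N f' j - f' j) by ring]
  refine h.congr_fun fun k => ?_
  ring

theorem resolvent_zero {K : ℤ → ℤ → ℂ} {N : ℤ} (hK : OneSubInvertible K N) :
    resolvent K N (fun _ => 0) = fun _ => 0 := by
  refine IsResolventImage.eq_resolvent hK fun j => ?_
  simp [hasSum_zero]

theorem resolvent_const_mul {K : ℤ → ℤ → ℂ} {N : ℤ} (hK : OneSubInvertible K N)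
    (f : Set.Ici N → ℂ) (c : ℂ) :
    resolvent K N (fun j => c * f j) = fun j => c * resolvent K N f j := by
  have := resolvent_mul_add hK f (fun _ => 0) c
  rw [resolvent_zero hK] at this
  simpa using this

/-- The sequence `(1 - K_n)⁻¹ (j ↦ -⟨F, rowFun j⟩)`. -/
noncomputable def resSeq (a : ℝ) (n m : ℕ) (F : ℂ → ℂ) : Set.Ici (2 * (m : ℤ) + 1) → ℂ :=
  resolvent (Kn a n) (2 * (m : ℤ) + 1) fun j => -pairing a F (rowFun a n j)

/-- `∑ k, resSeq F k * ⟨colFun k, B⟩` with `B = blackFun x r`. -/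
noncomputable def corrTerm (a : ℝ) (n m : ℕ) (x r : ℤ) (F : ℂ → ℂ) : ℂ :=
  ∑' k : Set.Ici (2 * (m : ℤ) + 1), resSeq a n m F k * pairing a (colFun a n k) (blackFun a n m x r)

/-- The pairing factor vanishes for large k, so the series over k converge whatever the growth of
the resolvent sequence. -/
theorem finite_support_mul_pairing (ha : 0 < a) {n m : ℕ} (x : ℤ) {r : ℤ} (h0 : 0 ≤ r)
    (g : Set.Ici (2 * (m : ℤ) + 1) → ℂ) :
    (Function.support fun k : Set.Ici (2 * (m : ℤ) + 1) =>
      g k * pairing a (colFun a n k) (blackFun a n m x r)).Finite := by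
  have : (Set.Icc (2 * (m : ℤ) + 1) (max (n + 1) (r - x + m + 1))).Finite := Set.finite_Icc _ _
  refine (this.preimage (Subtype.val_injective.injOn)).subset fun k hk => ?_
  refine ⟨k.2, ?_⟩
  by_contra! h
  refine hk ?_
  simp only
  rw [pairing_colFun_blackFun_eq_zero ha h0, mul_zero]
  · exact (le_max_left _ _).trans h.le
  · have := (le_max_right _ _).trans_lt h
    linarith

theorem summable_mul_pairing (ha : 0 < a) {n m : ℕ} (x : ℤ) {r : ℤ} (h0 : 0 ≤ r)
    (g : Set.Ici (2 * (m : ℤ) + 1) → ℂ) :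
    Summable fun k : Set.Ici (2 * (m : ℤ) + 1) =>
      g k * pairing a (colFun a n k) (blackFun a n m x r) :=
  summable_of_hasFiniteSupport (finite_support_mul_pairing ha x h0 g)

theorem resSeq_congr (ha : 0 < a) (n m : ℕ) {F G : ℂ → ℂ} (h : ∀ z ∈ ann a, F z = G z) :
    resSeq a n m F = resSeq a n m G := by
  unfold resSeq
  congr 1
  funext j
  rw [pairing_congr ha h fun _ _ => rfl]

theorem resSeq_mul_add (ha : 0 < a) {n m : ℕ} (hK : OneSubInvertible (Kn a n) (2 * (m : ℤ) + 1))
    {F G : ℂ → ℂ} (hF : HasSplit a F) (hG : HasSplit a G) (c : ℂ) :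
    resSeq a n m (fun z => c * F z + G z)
      = fun k => c * resSeq a n m F k + resSeq a n m G k := by
  unfold resSeq
  rw [← resolvent_mul_add hK]
  congr 1
  funext j
  rw [pairing_left_add ha hF hG (rowFun_hasSplit ha n j)]
  ring

theorem corrTerm_mul_add (ha : 0 < a) {n m : ℕ}
    (hK : OneSubInvertible (Kn a n) (2 * (m : ℤ) + 1)) (x : ℤ) {r : ℤ} (hr : 0 ≤ r)
    {F G : ℂ → ℂ} (hF : HasSplit a F) (hG : HasSplit a G) (c : ℂ) :
    corrTerm a n m x r (fun z => c * F z + G z)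
      = c * corrTerm a n m x r F + corrTerm a n m x r G := by
  unfold corrTerm
  rw [resSeq_mul_add ha hK hF hG, ← tsum_mul_left, ← Summable.tsum_add
    ((summable_mul_pairing ha x hr _).mul_left c) (summable_mul_pairing ha x hr _)]
  congr 1
  funext k
  ring

/-- The part of the kernel that is linear in the function `F` of the white vertex. -/
noncomputable def linKernel (a : ℝ) (n m : ℕ) (x r : ℤ) (F : ℂ → ℂ) : ℂ :=
  pairing a (blackFun a n m x r) F - corrTerm a n m x r F

theorem linKernel_congr (ha : 0 < a) {n m : ℕ} (x r : ℤ) {F G : ℂ → ℂ}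
    (h : ∀ z ∈ ann a, F z = G z) : linKernel a n m x r F = linKernel a n m x r G := by
  unfold linKernel corrTerm
  rw [resSeq_congr ha n m h, pairing_congr ha (fun _ _ => rfl) h]

theorem linKernel_mul_add (ha : 0 < a) {n m : ℕ}
    (hK : OneSubInvertible (Kn a n) (2 * (m : ℤ) + 1)) (x : ℤ) {r : ℤ} (hr : 0 ≤ r)
    {F G : ℂ → ℂ} (hF : HasSplit a F) (hG : HasSplit a G) (c : ℂ) :
    linKernel a n m x r (fun z => c * F z + G z)
      = c * linKernel a n m x r F + linKernel a n m x r G := by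
  unfold linKernel
  rw [corrTerm_mul_add ha hK x hr hF hG,
    pairing_right_add ha (blackFun_hasSplit ha n m x r) hF.continuousOn hG.continuousOn]
  ring

theorem pairingTerm_eq (ha : 0 < a) {n m : ℕ} (hK : OneSubInvertible (Kn a n) (2 * (m : ℤ) + 1))
    (r x s y : ℤ) (k : Set.Ici (2 * (m : ℤ) + 1)) :
    pairingTerm a n m (2 * r) x (2 * s + 1) y k
      = ((-1) ^ (x - y)) * (resSeq a n m (whiteFun a n m y s) k *
        pairing a (colFun a n k) (blackFun a n m x r)) := by
  unfold pairingTerm resSeq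
  simp only [aFun_eq ha, bFun_eq ha]
  rw [resolvent_const_mul hK, neg_one_zpow_sub]
  ring

/-- Black vertices have even z = 2r and white ones odd z = 2s + 1. The signs of ψ, S and the
correction all cancel against the prefactor (-1)^(x-y). -/
theorem kKernel_eq (ha : 0 < a) {n m : ℕ} (hK : OneSubInvertible (Kn a n) (2 * (m : ℤ) + 1))
    (r x s y : ℤ) :
    kKernel a n m (2 * r) x (2 * s + 1) y
      = linKernel a n m x r (whiteFun a n m y s)
        - if s < r then innerInt a (fun z => blackFun a n m x r z * whiteFun a n m y s z)
          else 0 := by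
  unfold kKernel K0
  simp only [pairingTerm_eq ha hK]
  rw [tsum_mul_left, S_eq ha, psi_eq ha n m]
  have h1 : (2 * s + 1 < 2 * r) ↔ s < r := by omega
  have h2 := neg_one_zpow_mul_self (x - y)
  unfold linKernel corrTerm
  simp only [h1]
  split_ifs
  · linear_combination (pairing a (blackFun a n m x r) (whiteFun a n m y s) -
      (innerInt a fun z => blackFun a n m x r z * whiteFun a n m y s z) -
      ∑' k : Set.Ici (2 * (m : ℤ) + 1), resSeq a n m (whiteFun a n m y s) k *
        pairing a (colFun a n k) (blackFun a n m x r)) * h2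
  · linear_combination (pairing a (blackFun a n m x r) (whiteFun a n m y s) -
      ∑' k : Set.Ici (2 * (m : ℤ) + 1), resSeq a n m (whiteFun a n m y s) k *
        pairing a (colFun a n k) (blackFun a n m x r)) * h2

/-! ### The relation between the functions of the neighbours of a black vertex -/

/-- The lower pair supplies a factor 1 + a z, the upper pair in `whiteFun_upper` a factor 1 - a/z;
both combinations reach the same function. -/
theorem whiteFun_lower (ha : 0 < a) (n m : ℕ) (x r : ℤ) {z : ℂ} (hz : z ∈ ann a) :
    whiteFun a n m x (r - 1) z + a * whiteFun a n m (x - 1) (r - 1) z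
      = mono a (m - x) r (n - r + 1) z := by
  unfold whiteFun mono
  rw [show (n : ℤ) - (r - 1) = n - r + 1 by ring, show (m : ℤ) - (x - 1) = m - x + 1 by ring,
    zpow_add_one₀ (ann_ne_zero ha hz), zpow_sub_one₀ (ann_one_add_ne_zero ha hz)]
  have h1 := ann_one_add_ne_zero ha hz
  have h0 := ann_ne_zero ha hz
  field_simp

theorem whiteFun_upper (ha : 0 < a) (n m : ℕ) (x r : ℤ) {z : ℂ} (hz : z ∈ ann a) :
    whiteFun a n m x r z + -a * whiteFun a n m (x + 1) r z
      = mono a (m - x) r (n - r + 1) z := by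
  unfold whiteFun mono
  rw [show (m : ℤ) - (x + 1) = m - x - 1 by ring, zpow_sub_one₀ (ann_ne_zero ha hz),
    zpow_add_one₀ (ann_one_sub_ne_zero ha hz)]
  ring

/-- The linear parts cancel between the upper and lower pairs. If r' ≠ r, the ψ-terms are present in
both pairs or in neither and cancel as well. If r' = r, only the lower pair has them, and the
integrand reduces to z^(x-x'-1), whose residue is δ. -/
theorem kernel_four_term (ha : 0 < a) {n m : ℕ}
    (hK : OneSubInvertible (Kn a n) (2 * (m : ℤ) + 1)) (x : ℤ) {r : ℤ} (hr : 0 ≤ r) (x' r' : ℤ) :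
    kKernel a n m (2 * r) x (2 * r' + 1) x' - a * kKernel a n m (2 * r) x (2 * r' + 1) (x' + 1)
      - kKernel a n m (2 * r) x (2 * (r' - 1) + 1) x'
      - a * kKernel a n m (2 * r) x (2 * (r' - 1) + 1) (x' - 1)
      = if x = x' ∧ r = r' then 1 else 0 := by
  have hW := fun y s => whiteFun_hasSplit ha n m y s
  have hB := (blackFun_hasSplit ha n m x r).continuousOn
  have hlow : linKernel a n m x r (whiteFun a n m x' (r' - 1))
      + a * linKernel a n m x r (whiteFun a n m (x' - 1) (r' - 1))
      = linKernel a n m x r (mono a (m - x') r' (n - r' + 1)) := by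
    rw [add_comm, ← linKernel_mul_add ha hK x hr (hW _ _) (hW _ _)]
    exact linKernel_congr ha x r fun z hz => by rw [← whiteFun_lower ha n m x' r' hz, add_comm]
  have hup : linKernel a n m x r (whiteFun a n m x' r')
      + -a * linKernel a n m x r (whiteFun a n m (x' + 1) r')
      = linKernel a n m x r (mono a (m - x') r' (n - r' + 1)) := by
    rw [add_comm, ← linKernel_mul_add ha hK x hr (hW _ _) (hW _ _)]
    exact linKernel_congr ha x r fun z hz => by rw [← whiteFun_upper ha n m x' r' hz, add_comm]
  have ilow : innerInt a (fun z => blackFun a n m x r z * whiteFun a n m x' (r' - 1) z)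
      + a * innerInt a (fun z => blackFun a n m x r z * whiteFun a n m (x' - 1) (r' - 1) z)
      = innerInt a (fun z => blackFun a n m x r z * mono a (m - x') r' (n - r' + 1) z) := by
    rw [← innerInt_const_mul, ← innerInt_add ha (hB.fun_mul (hW _ _).continuousOn)
      (continuousOn_const.fun_mul (hB.fun_mul (hW _ _).continuousOn))]
    refine innerInt_congr ha fun z hz => ?_
    rw [← whiteFun_lower ha n m x' r' hz]
    ring
  have iup : innerInt a (fun z => blackFun a n m x r z * whiteFun a n m x' r' z)
      + -a * innerInt a (fun z => blackFun a n m x r z * whiteFun a n m (x' + 1) r' z)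
      = innerInt a (fun z => blackFun a n m x r z * mono a (m - x') r' (n - r' + 1) z) := by
    rw [← innerInt_const_mul, ← innerInt_add ha (hB.fun_mul (hW _ _).continuousOn)
      (continuousOn_const.fun_mul (hB.fun_mul (hW _ _).continuousOn))]
    refine innerInt_congr ha fun z hz => ?_
    rw [← whiteFun_upper ha n m x' r' hz]
    ring
  simp only [kKernel_eq ha hK]
  by_cases h : r' = r
  · subst h
    have hd : innerInt a (fun z => blackFun a n m x r' z * mono a (m - x') r' (n - r' + 1) z)
        = if x = x' then 1 else 0 := by
      rw [innerInt_congr ha (g := mono a (x - x' - 1) 0 0), innerInt_mono_zero_zero ha]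
      · congr 1
        exact propext ⟨fun h => by omega, fun h => by omega⟩
      · intro z hz
        unfold blackFun
        rw [mono_mul_mono ha hz]
        congr 1 <;> ring
    simp only [lt_irrefl, show r' - 1 < r' by omega, if_true, if_false, and_true, ← hd]
    linear_combination hup - hlow + ilow
  · have h' : ¬(x = x' ∧ r = r') := fun h' => h h'.2.symm
    rcases lt_or_gt_of_ne h with h | h
    · simp only [h, h', show r' - 1 < r by omega, if_true, if_false]
      linear_combination hup - hlow + ilow - iup
    · simp only [h', show ¬r' < r by omega, show ¬r' - 1 < r by omega, if_false]
      linear_combination hup - hlow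

/-! ### Vanishing at the missing neighbours -/

theorem resSeq_eq_zero {n m : ℕ}
    (hK : OneSubInvertible (Kn a n) (2 * (m : ℤ) + 1)) {F : ℂ → ℂ}
    (h : ∀ j, 2 * (m : ℤ) + 1 ≤ j → pairing a F (rowFun a n j) = 0) :
    resSeq a n m F = fun _ => 0 := by
  unfold resSeq
  rw [← resolvent_zero hK]
  congr 1
  funext j
  rw [h j j.2, neg_zero]

/-- The white function behaves like z⁻¹ at infinity, so it is outer and the correction vanishes, and
what is left is ∮ black · white. The ψ-term cancels this for s < r; for s ≥ r the integrand is
O(z⁻²). -/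
theorem kernel_left_eq_zero (ha : 0 < a) {n m : ℕ}
    (hK : OneSubInvertible (Kn a n) (2 * (m : ℤ) + 1)) {x r s y : ℤ}
    (hs : 0 ≤ s) (hy : y = s + m + 1) (hx : x ≤ r + m) :
    kKernel a n m (2 * r) x (2 * s + 1) y = 0 := by
  rw [kKernel_eq ha hK]
  have ho : IsOuter a (whiteFun a n m y s) := mono_isOuter ha _ hs (by omega)
  have h0 : corrTerm a n m x r (whiteFun a n m y s) = 0 := by
    unfold corrTerm
    rw [resSeq_eq_zero hK fun j _ => pairing_left_outer ha ho _]
    simp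
  have h1 := pairing_add_pairing ha (blackFun_hasSplit ha n m x r) (whiteFun_hasSplit ha n m y s)
  rw [pairing_left_outer ha ho, add_zero] at h1
  unfold linKernel
  rw [h0, h1, sub_zero]
  split_ifs with h
  · ring
  · rw [sub_zero]
    refine (innerInt_congr ha fun z hz => mono_mul_mono ha hz _ _ _ _ _ _).trans ?_
    exact innerInt_mono_eq_zero ha _ (by omega) (by omega)

/-- In row s = n the factor 1 - a/z is gone and the white function is a polynomial. Its product with
a row function of index j ≥ 2m + 1 is O(z⁻²), by y ≥ -m, so the correction vanishes. -/
theorem kernel_top_eq_zero (ha : 0 < a) {n m : ℕ}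
    (hK : OneSubInvertible (Kn a n) (2 * (m : ℤ) + 1)) {x r y : ℤ}
    (hr : r ≤ n) (hy : -m ≤ y) (hy' : y ≤ m) :
    kKernel a n m (2 * r) x (2 * n + 1) y = 0 := by
  rw [kKernel_eq ha hK, if_neg (by omega)]
  have hi : IsInner a (whiteFun a n m y n) := mono_isInner ha (by omega) (by omega)
  have h0 : corrTerm a n m x r (whiteFun a n m y n) = 0 := by
    unfold corrTerm
    rw [resSeq_eq_zero hK fun j hj => ?_]
    · simp
    · have h1 := pairing_add_pairing ha (whiteFun_hasSplit ha n m y n) (rowFun_hasSplit ha n j)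
      rw [pairing_right_inner ha (rowFun_hasSplit ha n j) hi, add_zero] at h1
      rw [h1, innerInt_congr ha
        (g := fun z => (-1) ^ j * mono a (m - y + (-j - 1)) (n + -n) (n - n + -(n + 1)) z),
        innerInt_const_mul, innerInt_mono_eq_zero ha _ (by omega) (by omega), mul_zero]
      intro z hz
      unfold whiteFun rowFun
      rw [← mono_mul_mono ha hz]
      ring
  unfold linKernel
  rw [h0, pairing_right_inner ha (blackFun_hasSplit ha n m x r) hi]
  ring

theorem InnerHol.exists_eq_add (ha : 0 < a) {f : ℂ → ℂ} (hf : InnerHol a f) :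
    ∃ g, InnerHol a g ∧ ∀ z, f z = f 0 + z * g z := by
  refine ⟨dslope f 0, (Complex.differentiableOn_dslope (Metric.isOpen_ball.mem_nhds ?_)).2 hf,
    fun z => ?_⟩
  · refine Metric.closedBall_subset_ball ?_ (zero_mem_closedBall ha)
    have : 0 < 1 / a := by positivity
    linarith
  · have := sub_smul_dslope f 0 z
    simp only [sub_zero, smul_eq_mul] at this
    rw [this]
    ring

theorem mono_mul_hasSplit (ha : 0 < a) {n : ℕ} {k : ℤ} {f : ℂ → ℂ} (hf : InnerHol a f) :
    HasSplit a fun z => mono a k n (n + 1) z * f z := by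
  have h0 := innerHol_sub_zpow (a := a) 0 (Int.natCast_nonneg (k - (n + 1)).toNat)
  have h1 := innerHol_sub_zpow (a := a) (a : ℂ) (show (0 : ℤ) ≤ n + 1 by omega)
  have h2 : IsInner a _ :=
    ⟨_, ((h0.mul h1).mul (innerHol_one_add_zpow ha n)).mul hf, fun _ _ => rfl⟩
  refine (h2.hasSplit.sub_zpow_neg_mul ha (zero_mem_closedBall ha)
    (-(k - (n + 1))).toNat).congr fun z hz => ?_
  rw [mono_eq ha hz, zpow_split (ann_ne_zero ha hz) (k - (n + 1))]
  simp only [sub_zero]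
  ring

/-- If `F` is `(1 + a z) ^ n (1 - a / z) ^ (n + 1) z ^ k f` with `f` holomorphic and
`k ≥ 2 m + 1`, then the correction compensates `⟨F, B⟩`. -/
theorem pairing_add_corrTerm_eq_zero (ha : 0 < a) {n m : ℕ}
    (hK : OneSubInvertible (Kn a n) (2 * (m : ℤ) + 1)) {x r : ℤ} (h0 : 0 ≤ r) (d : ℕ) :
    ∀ (k : ℤ) (f : ℂ → ℂ), 2 * (m : ℤ) + 1 ≤ k → max ((n : ℤ) + 1) (r - x + m + 1) ≤ k + d →
      InnerHol a f →
      pairing a (fun z => mono a k n (n + 1) z * f z) (blackFun a n m x r)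
        + corrTerm a n m x r (fun z => mono a k n (n + 1) z * f z) = 0 := by
  -- Each step splits off f(0), a multiple of one column function, and raises k by one; `d` bounds
  -- the steps needed until both pairings vanish.
  induction d with
  | zero =>
    intro k f hk hkd hf
    have hB := blackFun_hasSplit ha n m x r
    have hF := mono_mul_hasSplit ha (n := n) (k := k) hf
    have hk1 : (n : ℤ) + 1 ≤ k := by have := le_max_left ((n : ℤ) + 1) (r - x + m + 1); omega
    have hk2 : r - x + m + 1 ≤ k := by have := le_max_right ((n : ℤ) + 1) (r - x + m + 1); omega
    have hi : IsInner a fun z => mono a k n (n + 1) z * f z :=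
      (mono_isInner ha (by omega) hk1).mul ⟨f, hf, fun _ _ => rfl⟩
    have h1 := pairing_add_pairing ha hF hB
    rw [pairing_right_inner ha hB hi, add_zero] at h1
    have h2 : innerInt a (fun z => mono a k n (n + 1) z * f z * blackFun a n m x r z) = 0 := by
      rw [innerInt_congr ha (g := fun z => mono a (k + (x - m - 1)) (n + -r) (n + 1 + (r - n - 1)) z
        * f z)]
      · exact innerInt_isInner ha ((mono_isInner ha (by omega) (by omega)).mul
          ⟨f, hf, fun _ _ => rfl⟩)
      · intro z hz
        unfold blackFun
        rw [← mono_mul_mono ha hz]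
        ring
    rw [h1, h2, zero_add]
    have hrow : ∀ j < k, pairing a (fun z => mono a k n (n + 1) z * f z) (rowFun a n j) = 0 := by
      intro j hj
      have h3 := pairing_add_pairing ha hF (rowFun_hasSplit ha n j)
      rw [pairing_right_inner ha (rowFun_hasSplit ha n j) hi, add_zero] at h3
      rw [h3, innerInt_congr ha
        (g := fun z => (-1) ^ j * (mono a (k + (-j - 1)) (n + -n) (n + 1 + -(n + 1)) z * f z)),
        innerInt_const_mul, innerInt_isInner ha ((mono_isInner ha (by omega) (by omega)).mul
          ⟨f, hf, fun _ _ => rfl⟩), mul_zero]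
      intro z hz
      unfold rowFun
      rw [← mono_mul_mono ha hz]
      ring
    -- The right-hand side is supported on indices ≥ k ≥ n + 1, where the columns of `Kn` are zero,
    -- so the resolvent fixes it.
    have hres : resSeq a n m (fun z => mono a k n (n + 1) z * f z)
        = fun j : Set.Ici (2 * (m : ℤ) + 1) =>
          -pairing a (fun z => mono a k n (n + 1) z * f z) (rowFun a n j) := by
      refine IsResolventImage.eq_resolvent hK fun j => ?_
      rw [sub_self]
      convert (hasSum_zero : HasSum (fun _ : Set.Ici (2 * (m : ℤ) + 1) => (0 : ℂ)) 0) using 2 with l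
      rcases lt_or_ge (l : ℤ) k with hl | hl
      · rw [hrow _ hl]; simp
      · rw [Kn_eq_zero ha _ (hk1.trans hl)]; simp
    unfold corrTerm
    rw [hres]
    convert tsum_zero with j
    beta_reduce
    rcases lt_or_ge (j : ℤ) k with hl | hl
    · rw [hrow _ hl]; simp
    · rw [pairing_colFun_blackFun_eq_zero ha h0 (hk1.trans hl) (by omega)]; simp
  | succ d ih =>
    intro k f hk hkd hf
    have hB := blackFun_hasSplit ha n m x r
    obtain ⟨g, hg, hfg⟩ := hf.exists_eq_add ha
    have hF : ∀ z ∈ ann a, mono a k n (n + 1) z * f z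
        = ((-1) ^ k * f 0) * colFun a n k z + mono a (k + 1) n (n + 1) z * g z := by
      intro z hz
      unfold colFun
      have e : mono a (k + 1) n (n + 1) z = z * mono a k n (n + 1) z := by
        unfold mono
        rw [zpow_add_one₀ (ann_ne_zero ha hz)]
        ring
      rw [e, hfg z]
      linear_combination (-f 0 * mono a k n (n + 1) z) * neg_one_zpow_mul_self k
    have hcol := colFun_hasSplit ha n k
    have hg' := mono_mul_hasSplit ha (n := n) (k := k + 1) hg
    have hcorr : ∀ {F G : ℂ → ℂ}, (∀ z ∈ ann a, F z = G z) →
        corrTerm a n m x r F = corrTerm a n m x r G := by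
      intro F G h
      unfold corrTerm
      rw [resSeq_congr ha n m h]
    rw [pairing_congr ha hF fun _ _ => rfl, hcorr hF,
      pairing_left_add ha hcol hg' hB, corrTerm_mul_add ha hK x h0 hcol hg']
    -- The sequence -⟨col k, row j⟩ is minus the k-th column of 1 - K_n, so the resolvent sends it
    -- to minus the k-th unit vector.
    have hres : resSeq a n m (colFun a n k)
        = fun j : Set.Ici (2 * (m : ℤ) + 1) => if j = ⟨k, hk⟩ then -1 else 0 := by
      refine IsResolventImage.eq_resolvent hK fun j => ?_
      have h3 := pairing_add_pairing ha (rowFun_hasSplit ha n j) hcol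
      rw [innerInt_rowFun_colFun ha, ← Kn_eq ha] at h3
      convert hasSum_single (f := fun l : Set.Ici (2 * (m : ℤ) + 1) =>
        Kn a n j l * if l = ⟨k, hk⟩ then -1 else 0) (⟨k, hk⟩ : Set.Ici (2 * (m : ℤ) + 1))
        (fun l hl => by simp [hl]) using 1
      simp only [Subtype.ext_iff, if_true]
      split_ifs with h
      · rw [if_pos h] at h3
        linear_combination h3
      · rw [if_neg h] at h3
        linear_combination h3
    have hcolcorr : corrTerm a n m x r (colFun a n k)
        = -pairing a (colFun a n k) (blackFun a n m x r) := by
      unfold corrTerm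
      rw [hres, tsum_eq_single ⟨k, hk⟩ (fun l hl => by simp [hl])]
      simp
    rw [hcolcorr]
    have := ih (k + 1) g (by omega) (by push_cast at hkd; omega) hg
    linear_combination this

/-- In row s = -1 the white function W is z^(m-y) (1 + a z)^n (1 - a/z)^(n+1) times a holomorphic
function, with m - y ≥ 2m + 1. The correction is therefore -⟨W, B⟩ for the black function B, and ⟨B,
W⟩ + ⟨W, B⟩ = ∮ B W is cancelled by the ψ-term. -/
theorem kernel_bottom_eq_zero (ha : 0 < a) {n m : ℕ}
    (hK : OneSubInvertible (Kn a n) (2 * (m : ℤ) + 1)) {x r y : ℤ}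
    (hr : 0 ≤ r) (hy : y ≤ -m - 1) :
    kKernel a n m (2 * r) x (2 * (-1) + 1) y = 0 := by
  rw [kKernel_eq ha hK, if_pos (by omega)]
  have hF : ∀ z ∈ ann a, whiteFun a n m y (-1) z
      = mono a (m - y) n (n + 1) z * (1 + a * z) ^ (-1 - (n : ℤ)) := by
    intro z hz
    unfold whiteFun mono
    rw [zpow_sub₀ (ann_one_add_ne_zero ha hz)]
    have := zpow_ne_zero (n : ℤ) (ann_one_add_ne_zero ha hz)
    field_simp
    ring_nf
  have h1 := pairing_add_corrTerm_eq_zero ha hK (x := x) hr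
    (max ((n : ℤ) + 1) (r - x + m + 1)).toNat (m - y) (fun z => (1 + a * z) ^ (-1 - (n : ℤ)))
    (by omega) (by omega) (innerHol_one_add_zpow ha _)
  have h2 := pairing_add_pairing ha (blackFun_hasSplit ha n m x r)
    (whiteFun_hasSplit ha n m y (-1))
  rw [pairing_congr ha (fun z hz => (hF z hz).symm) fun _ _ => rfl] at h1
  have h3 : corrTerm a n m x r (whiteFun a n m y (-1)) = corrTerm a n m x r
      fun z => mono a (m - y) n (n + 1) z * (1 + a * z) ^ (-1 - (n : ℤ)) := by
    unfold corrTerm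
    rw [resSeq_congr ha n m hF]
  unfold linKernel
  rw [h3]
  linear_combination h2 - h1

/-! ### The vertex sets and the matrix identities. -/

theorem mem_blackAD_iff (n m : ℕ) (q r : ℤ) : (2 * q, 2 * r - 1) ∈ blackAD n m ↔
    (0 ≤ q ∧ q ≤ 2 * m + n ∧ 1 ≤ r ∧ r ≤ n) ∨ (2 * m + 1 ≤ q ∧ q ≤ 2 * m + n ∧ r = 0) := by
  have h1 : Even (2 * q) := even_two_mul q
  have h2 : Odd (2 * r - 1) := ⟨r - 1, by ring⟩
  rw [mem_blackAD]
  simp only [h1, h2, true_and]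
  omega

theorem mem_whiteAD_iff (n m : ℕ) (p s : ℤ) : (2 * p + 1, 2 * s) ∈ whiteAD n m ↔
    (0 ≤ p ∧ p ≤ 2 * m + n ∧ 0 ≤ s ∧ s ≤ n - 1) ∨ (0 ≤ p ∧ p ≤ n - 1 ∧ s = n) := by
  have h1 : Even (2 * s) := even_two_mul s
  have h2 : Odd (2 * p + 1) := ⟨p, rfl⟩
  rw [mem_whiteAD]
  simp only [h1, h2, true_and]
  omega

theorem exists_of_mem_blackAD {n m : ℕ} {b : ℤ × ℤ} (hb : b ∈ blackAD n m) :
    ∃ q r : ℤ, b = (2 * q, 2 * r - 1) := by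
  obtain ⟨⟨q, hq⟩, ⟨r, hr⟩, -⟩ := (mem_blackAD n m b).1 hb
  exact ⟨q, r + 1, Prod.ext (by simp only; omega) (by simp only; omega)⟩

theorem exists_of_mem_whiteAD {n m : ℕ} {w : ℤ × ℤ} (hw : w ∈ whiteAD n m) :
    ∃ p s : ℤ, w = (2 * p + 1, 2 * s) := by
  obtain ⟨⟨q, hq⟩, ⟨r, hr⟩, -⟩ := (mem_whiteAD n m w).1 hw
  exact ⟨q, r, Prod.ext (by simp only; omega) (by simp only; omega)⟩

/-- A diagonal shift matches the full rows; the two exceptional rows, black at height -1 and white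
at height 2n, have n vertices each. -/
theorem card_blackAD_eq_card_whiteAD (n m : ℕ) : (blackAD n m).card = (whiteAD n m).card := by
  refine Finset.card_bij'
    (fun b _ => if b.2 = -1 then (b.1 - 4 * m - 1, 2 * n) else (b.1 + 1, b.2 - 1))
    (fun w _ => if w.2 = 2 * n then (w.1 + 4 * m + 1, -1) else (w.1 - 1, w.2 + 1)) ?_ ?_ ?_ ?_
  · intro b hb
    obtain ⟨q, r, rfl⟩ := exists_of_mem_blackAD hb
    rw [mem_blackAD_iff] at hb
    split_ifs with h <;> simp only at h
    · rw [show ((2 * q : ℤ) - 4 * m - 1, (2 * n : ℤ)) = (2 * (q - 2 * m - 1) + 1, 2 * (n : ℤ)) by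
        congr 1; ring, mem_whiteAD_iff]
      omega
    · rw [show ((2 * q : ℤ) + 1, 2 * r - 1 - 1) = (2 * q + 1, 2 * (r - 1)) by
        congr 1; ring, mem_whiteAD_iff]
      omega
  · intro w hw
    obtain ⟨p, s, rfl⟩ := exists_of_mem_whiteAD hw
    rw [mem_whiteAD_iff] at hw
    split_ifs with h <;> simp only at h
    · rw [show ((2 * p + 1 : ℤ) + 4 * m + 1, (-1 : ℤ)) = (2 * (p + 2 * m + 1), 2 * 0 - 1) by
        congr 1; ring, mem_blackAD_iff]
      omega
    · rw [show ((2 * p + 1 : ℤ) - 1, 2 * s + 1) = (2 * p, 2 * (s + 1) - 1) by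
        congr 1 <;> ring, mem_blackAD_iff]
      omega
  · intro b hb
    obtain ⟨q, r, rfl⟩ := exists_of_mem_blackAD hb
    rw [mem_blackAD_iff] at hb
    by_cases h : 2 * r - 1 = -1
    · simp only [h, if_true]
      congr 1; ring
    · have h' : ¬ 2 * r - 1 - 1 = 2 * (n : ℤ) := by omega
      simp only [h, h', if_false]
      congr 1 <;> ring
  · intro w hw
    obtain ⟨p, s, rfl⟩ := exists_of_mem_whiteAD hw
    rw [mem_whiteAD_iff] at hw
    by_cases h : 2 * s = 2 * (n : ℤ)
    · simp only [h, if_true]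
      congr 1; ring
    · have h' : ¬ 2 * s + 1 = -1 := by omega
      simp only [h, h', if_false]
      congr 1 <;> ring

/-- A neighbour of a black vertex can be missing only in column p = -1 or in row s = -1 or s = n;
the shapes of the two sets give the inequalities on y. -/
theorem kKernel_missing_neighbour (ha : 0 < a) {n m : ℕ}
    (hK : OneSubInvertible (Kn a n) (2 * (m : ℤ) + 1)) {q r q' r' p s : ℤ}
    (hb : (2 * q, 2 * r - 1) ∈ blackAD n m) (hb' : (2 * q', 2 * r' - 1) ∈ blackAD n m)
    (hp : p = q' ∨ p = q' - 1) (hs : s = r' ∨ s = r' - 1)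
    (hw : (2 * p + 1, 2 * s) ∉ whiteAD n m) :
    kKernel a n m (2 * r) (r - q + m) (2 * s + 1) (s - p + m) = 0 := by
  rw [mem_blackAD_iff] at hb hb'
  rw [mem_whiteAD_iff] at hw
  by_cases h1 : p = -1
  · exact kernel_left_eq_zero ha hK (by omega) (by omega) (by omega)
  by_cases h2 : s = -1
  · subst h2
    exact kernel_bottom_eq_zero ha hK (by omega) (by omega)
  · obtain rfl : s = n := by omega
    exact kernel_top_eq_zero ha hK (by omega) (by omega) (by omega)

theorem neg_one_cpow_quarter (t : ℤ) : (-1 : ℂ) ^ (((2 * t : ℤ) : ℂ) / 4) = I ^ t := by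
  rw [cpow_def_of_ne_zero (by norm_num), log_neg_one,
    show (Real.pi : ℂ) * I * (((2 * t : ℤ) : ℂ) / 4) = t * (Real.pi / 2 * I) by push_cast; ring,
    exp_int_mul, exp_pi_div_two_mul_I]

theorem kasteleyn_mul_kernelMatrix (ha : 0 < a) {n m : ℕ}
    (hK : OneSubInvertible (Kn a n) (2 * (m : ℤ) + 1)) :
    kasteleyn a n m * kernelMatrix a n m = 1 := by
  ext ⟨b', hb'⟩ ⟨b, hb⟩
  rw [Matrix.mul_apply, Matrix.one_apply]
  simp only [kasteleyn, kernelMatrix, Matrix.of_apply, Subtype.mk.injEq]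
  obtain ⟨q, r, rfl⟩ := exists_of_mem_blackAD hb
  obtain ⟨q', r', rfl⟩ := exists_of_mem_blackAD hb'
  set f : ℤ × ℤ → ℂ := fun w => kasteleynEntry a (2 * q', 2 * r' - 1) w *
    (-(-1 : ℂ) ^ (((w.1 - w.2 + 2 * q - (2 * r - 1) + 2 : ℤ) : ℂ) / 4) *
      kKernel a n m (zCoord (2 * q, 2 * r - 1)) (xCoord m (2 * q, 2 * r - 1)) (zCoord w)
        (xCoord m w)) with hf
  have hsum : ∑ w : whiteAD n m, f w = ∑ w ∈ whiteAD n m, f w :=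
    Finset.sum_coe_sort (whiteAD n m) f
  refine hsum.trans ?_
  have hN : ∀ w : ℤ × ℤ, w ∉ ({(2 * q' + 1, 2 * r'), (2 * (q' - 1) + 1, 2 * r'),
      (2 * (q' - 1) + 1, 2 * (r' - 1)), (2 * q' + 1, 2 * (r' - 1))} : Finset (ℤ × ℤ)) →
      f w = 0 := by
    rintro ⟨w1, w2⟩ hw
    simp only [Finset.mem_insert, Finset.mem_singleton, Prod.mk.injEq, not_or] at hw
    simp only [hf, kasteleynEntry, Prod.mk_add_mk, Prod.mk_sub_mk, Prod.mk.injEq]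
    rw [if_neg (by omega), if_neg (by omega), if_neg (by omega), if_neg (by omega), zero_mul]
  have hz : zCoord (2 * q, 2 * r - 1) = 2 * r := by simp only [zCoord]; ring
  have hx : xCoord m (2 * q, 2 * r - 1) = r - q + m := by simp only [xCoord]; omega
  have hz' : ∀ p s : ℤ, zCoord (2 * p + 1, 2 * s) = 2 * s + 1 := fun p s => rfl
  have hx' : ∀ p s : ℤ, xCoord m (2 * p + 1, 2 * s) = s - p + m := fun p s => by
    simp only [xCoord]; omega
  have hval : ∀ p s : ℤ, f (2 * p + 1, 2 * s) = kasteleynEntry a (2 * q', 2 * r' - 1)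
      (2 * p + 1, 2 * s) * (-I ^ (p - s + q - r + 2) *
        kKernel a n m (2 * r) (r - q + m) (2 * s + 1) (s - p + m)) := by
    intro p s
    simp only [hf, hz, hx, hz', hx']
    rw [← neg_one_cpow_quarter]
    congr 5
    ring_nf
  have hmiss : ∀ w ∈ ({(2 * q' + 1, 2 * r'), (2 * (q' - 1) + 1, 2 * r'),
      (2 * (q' - 1) + 1, 2 * (r' - 1)), (2 * q' + 1, 2 * (r' - 1))} : Finset (ℤ × ℤ)),
      w ∉ whiteAD n m → f w = 0 := by
    intro w hw hw'
    simp only [Finset.mem_insert, Finset.mem_singleton] at hw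
    rcases hw with rfl | rfl | rfl | rfl <;>
    · rw [hval, kKernel_missing_neighbour ha hK hb hb' (by omega) (by omega) hw']
      ring
  -- Missing neighbours contribute zero, so the sum over the white vertices becomes a sum over all
  -- four neighbours.
  rw [Finset.sum_subset Finset.subset_union_left (fun w hw hw' =>
      hmiss w ((Finset.mem_union.1 hw).resolve_left hw') hw'),
    ← Finset.sum_subset Finset.subset_union_right (fun w _ hw' => hN w hw'),
    Finset.sum_insert (by simp; omega), Finset.sum_insert (by simp; omega),
    Finset.sum_insert (by simp), Finset.sum_singleton]
  have four := kernel_four_term ha hK (r - q + m) (r := r)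
    (by rw [mem_blackAD_iff] at hb; omega) (r' - q' + m) r'
  simp only [hval]
  have k1 : kasteleynEntry a (2 * q', 2 * r' - 1) (2 * q' + 1, 2 * r') = (-1) ^ (-(q' + r')) := by
    simp only [kasteleynEntry, Prod.mk_add_mk, Prod.mk.injEq]
    rw [if_pos ⟨trivial, by omega⟩]
    congr 1
    omega
  have k2 : kasteleynEntry a (2 * q', 2 * r' - 1) (2 * (q' - 1) + 1, 2 * r')
      = (-1) ^ (-(q' + r')) * (-a * I) := by
    simp only [kasteleynEntry, Prod.mk_add_mk, Prod.mk.injEq]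
    rw [if_neg (by omega), if_pos (by omega)]
    congr 2
    omega
  have k3 : kasteleynEntry a (2 * q', 2 * r' - 1) (2 * (q' - 1) + 1, 2 * (r' - 1))
      = -(-1) ^ (-(q' + r')) := by
    simp only [kasteleynEntry, Prod.mk_add_mk, Prod.mk_sub_mk, Prod.mk.injEq]
    rw [if_neg (by omega), if_neg (by omega), if_pos (by omega), ← mul_neg_one ((-1 : ℂ) ^ _),
      ← zpow_add_one₀ (by norm_num : (-1 : ℂ) ≠ 0)]
    congr 1
    omega
  have k4 : kasteleynEntry a (2 * q', 2 * r' - 1) (2 * q' + 1, 2 * (r' - 1))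
      = -(-1) ^ (-(q' + r')) * (-a * I) := by
    simp only [kasteleynEntry, Prod.mk_add_mk, Prod.mk_sub_mk, Prod.mk.injEq]
    rw [if_neg (by omega), if_neg (by omega), if_neg (by omega), if_pos (by omega), ← mul_neg_one ((-1 : ℂ) ^ _),
      ← zpow_add_one₀ (by norm_num : (-1 : ℂ) ≠ 0)]
    congr 2
    omega
  rw [k1, k2, k3, k4, show q' - 1 - r' + q - r + 2 = q' - r' + q - r + 2 - 1 by ring,
    show q' - 1 - (r' - 1) + q - r + 2 = q' - r' + q - r + 2 by ring,
    show q' - (r' - 1) + q - r + 2 = q' - r' + q - r + 2 + 1 by ring,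
    zpow_sub_one₀ I_ne_zero, zpow_add_one₀ I_ne_zero, inv_I,
    show r' - (q' - 1) + m = r' - q' + m + 1 by ring,
    show r' - 1 - (q' - 1) + (m : ℤ) = r' - q' + m by ring,
    show r' - 1 - q' + (m : ℤ) = r' - q' + m - 1 by ring]
  -- On the diagonal the exponent of `I` is 2(q - r + 1), and (-1)^(-(q+r)) (-1)^(q-r+1) = -1.
  have hsgn : (if ((2 * q', 2 * r' - 1) : ℤ × ℤ) = (2 * q, 2 * r - 1) then (1 : ℂ) else 0)
      = -((-1) ^ (-(q' + r')) * I ^ (q' - r' + q - r + 2)) *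
        (if r - q + m = r' - q' + (m : ℤ) ∧ r = r' then 1 else 0) := by
    by_cases h : q = q' ∧ r = r'
    · obtain ⟨rfl, rfl⟩ := h
      rw [if_pos rfl, if_pos ⟨rfl, rfl⟩, show q - r + q - r + 2 = 2 * (q - r + 1) by ring,
        zpow_mul, show I ^ (2 : ℤ) = -1 by rw [← I_sq]; norm_cast, ← zpow_add₀ (by norm_num),
        show -(q + r) + (q - r + 1) = 2 * (-r) + 1 by ring, zpow_add_one₀ (by norm_num), zpow_mul]
      norm_num
    · rw [if_neg, if_neg, mul_zero]
      · omega
      · rw [Prod.mk.injEq]; omega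
  rw [hsgn, ← four]
  linear_combination ((-1) ^ (-(q' + r')) * I ^ (q' - r' + q - r + 2) * a *
    (kKernel a n m (2 * r) (r - q + m) (2 * r' + 1) (r' - q' + m + 1) * (-1)
    + kKernel a n m (2 * r) (r - q + m) (2 * (r' - 1) + 1) (r' - q' + m - 1) * (-1))) * I_mul_I

theorem kernelMatrix_mul_kasteleyn (ha : 0 < a) {n m : ℕ}
    (hK : OneSubInvertible (Kn a n) (2 * (m : ℤ) + 1)) :
    kernelMatrix a n m * kasteleyn a n m = 1 := by
  refine (Matrix.mul_eq_one_comm_of_card_eq _ _ _ ?_).1 (kasteleyn_mul_kernelMatrix ha hK)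
  simpa using card_blackAD_eq_card_whiteAD n m

theorem summable_pairingTerm (ha : 0 < a) {n m : ℕ}
    (hK : OneSubInvertible (Kn a n) (2 * (m : ℤ) + 1)) {b w : ℤ × ℤ} (hb : b ∈ blackAD n m)
    (hw : w ∈ whiteAD n m) :
    Summable (pairingTerm a n m (zCoord b) (xCoord m b) (zCoord w) (xCoord m w)) := by
  obtain ⟨q, r, rfl⟩ := exists_of_mem_blackAD hb
  obtain ⟨p, s, rfl⟩ := exists_of_mem_whiteAD hw
  rw [mem_blackAD_iff] at hb
  rw [show zCoord (2 * q, 2 * r - 1) = 2 * r by simp only [zCoord]; ring,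
    show zCoord (2 * p + 1, 2 * s) = 2 * s + 1 from rfl]
  have := (summable_mul_pairing ha (m := m) (n := n) (xCoord m (2 * q, 2 * r - 1))
    (show 0 ≤ r by omega)
    (resSeq a n m (whiteFun a n m (xCoord m (2 * p + 1, 2 * s)) s))).mul_left
      ((-1) ^ (xCoord m (2 * q, 2 * r - 1) - xCoord m (2 * p + 1, 2 * s)))
  exact this.congr fun k => (pairingTerm_eq ha hK _ _ _ _ k).symm

end DoubleAztec

/-! ### Positivity of the finite Toeplitz system. -/

namespace DoubleAztec

open Polynomial Finset

theorem degree_lt_succ_of_natDegree_le {K : Type*} [Semiring K] {P : K[X]} {d : ℕ}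
    (hP : P.natDegree ≤ d) : P.degree < ((d + 1 : ℕ) : WithBot ℕ) :=
  (natDegree_le_iff_degree_le.1 hP).trans_lt (by exact_mod_cast Nat.lt_succ_self d)

/-- Polynomials of degree at most `d` that are triangular with respect to evaluation at
`0, …, d` span the polynomials of degree at most `d`. -/
theorem exists_eq_sum_of_eval_triangular {K : Type*} [Field K] [CharZero K] {d : ℕ}
    (Q : Fin (d + 1) → K[X]) (hdeg : ∀ k, (Q k).natDegree ≤ d)
    (hlow : ∀ k s : Fin (d + 1), s < k → (Q k).eval ((s : ℕ) : K) = 0)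
    (hdiag : ∀ k : Fin (d + 1), (Q k).eval ((k : ℕ) : K) ≠ 0) (P : K[X]) (hP : P.natDegree ≤ d) :
    ∃ x : Fin (d + 1) → K, P = ∑ k, C (x k) * Q k := by
  set V : Matrix (Fin (d + 1)) (Fin (d + 1)) K := Matrix.of fun s k => (Q k).eval ((s : ℕ) : K)
    with hV
  have hdet : IsUnit V := by
    rw [Matrix.isUnit_iff_isUnit_det, Matrix.det_of_isLowerTriangular V, isUnit_iff_ne_zero]
    · exact prod_ne_zero_iff.2 fun k _ => hdiag k
    · intro i j hij
      exact hlow j i hij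
  obtain ⟨x, hx⟩ := Matrix.mulVec_surjective_iff_isUnit.2 hdet
    (fun s : Fin (d + 1) => P.eval ((s : ℕ) : K))
  refine ⟨x, Polynomial.eq_of_degrees_lt_of_eval_index_eq (univ : Finset (Fin (d + 1)))
    (v := fun s : Fin (d + 1) => ((s : ℕ) : K)) ?_ ?_ ?_ ?_⟩
  · intro s _ t _ hst
    exact Fin.ext (Nat.cast_injective hst)
  · rw [card_univ, Fintype.card_fin]
    exact degree_lt_succ_of_natDegree_le hP
  · rw [card_univ, Fintype.card_fin]
    refine (degree_sum_le _ _).trans_lt ((Finset.sup_lt_iff (WithBot.bot_lt_coe _)).2 fun k _ => ?_)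
    exact degree_lt_succ_of_natDegree_le ((natDegree_C_mul_le _ _).trans (hdeg k))
  · intro s _
    have := congrFun hx s
    rw [← this, eval_finsetSum]
    simp only [Matrix.mulVec, dotProduct, hV, Matrix.of_apply, eval_mul, eval_C]
    exact sum_congr rfl fun k _ => mul_comm _ _

/-- This identity and `factorial_mul_choose_add` write shifted binomial coefficients as a common
weight in s times a polynomial in s of degree d. -/
theorem factorial_mul_choose_sub {n d s k : ℕ} (hs : s ≤ n + d) (hk : k ≤ d) (hks : k ≤ s) :
    s.factorial * (n + d - s).factorial * n.choose (s - k)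
      = n.factorial * (s.descFactorial k * (n + d - s).descFactorial (d - k)) := by
  rcases le_or_gt (s - k) n with h | h
  · rw [← Nat.choose_mul_factorial_mul_factorial h, ← Nat.factorial_mul_descFactorial hks,
      ← Nat.factorial_mul_descFactorial (show d - k ≤ n + d - s by omega),
      show n + d - s - (d - k) = n - (s - k) by omega]
    ring
  · rw [Nat.choose_eq_zero_of_lt h, Nat.descFactorial_of_lt (show n + d - s < d - k by omega)]
    simp

theorem factorial_mul_choose_add {n l d s i : ℕ} (hn : l + d = n) (hi : i ≤ d) :
    n.factorial * s.factorial * (s + l + i).choose n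
      = (s + l).factorial * ((s + l + i).descFactorial i * s.descFactorial (d - i)) := by
  have h1 := Nat.descFactorial_mul_descFactorial (n := s + l + i) (show i ≤ n by omega)
  have h2 := Nat.descFactorial_mul_descFactorial (n := s + l) (show l ≤ n - i by omega)
  have h3 := Nat.factorial_mul_descFactorial (show l ≤ s + l by omega)
  rw [Nat.add_sub_cancel] at h1 h2 h3
  rw [show n - i - l = d - i by omega] at h2
  rw [mul_right_comm, ← Nat.descFactorial_eq_factorial_mul_choose, ← h1, ← h2, ← h3]
  ring

theorem coeff_one_add_C_mul_X_pow (a : ℂ) (n j : ℕ) :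
    ((1 + C a * X : ℂ[X]) ^ n).coeff j = n.choose j * a ^ j := by
  have : (1 + C a * X : ℂ[X]) ^ n = ((1 + X : ℂ[X]) ^ n).comp (C a * X) := by simp
  rw [this, comp_C_mul_X_coeff, coeff_one_add_X_pow]

/-- The polynomial in `s` which is proportional to the coefficients of `c (1 + a X) ^ n`. -/
noncomputable def coeffPoly (a : ℂ) (n d : ℕ) (c : ℂ[X]) : ℂ[X] :=
  ∑ k ∈ range (d + 1), C (c.coeff k * (a ^ k)⁻¹) *
    (descPochhammer ℂ k * (descPochhammer ℂ (d - k)).comp (C ((n + d : ℕ) : ℂ) - X))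

theorem natDegree_coeffPoly_le (a : ℂ) (n d : ℕ) (c : ℂ[X]) :
    (coeffPoly a n d c).natDegree ≤ d := by
  refine natDegree_sum_le_of_forall_le _ _ fun k hk => ?_
  refine (natDegree_C_mul_le _ _).trans (natDegree_mul_le.trans ?_)
  have h1 : (C ((n + d : ℕ) : ℂ) - X : ℂ[X]).natDegree ≤ 1 := by
    refine (natDegree_sub_le _ _).trans (max_le ?_ natDegree_X.le)
    rw [natDegree_C]
    exact zero_le_one
  have h2 := natDegree_comp_le (p := descPochhammer ℂ (d - k)) (q := C ((n + d : ℕ) : ℂ) - X)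
  rw [descPochhammer_natDegree] at h2 ⊢
  have h3 := Nat.mul_le_mul_left (d - k) h1
  have := mem_range.1 hk
  omega

theorem factorial_mul_coeff_eq {a : ℂ} (ha : a ≠ 0) {n d s : ℕ} (hs : s ≤ n + d) {c : ℂ[X]}
    (hc : c.natDegree ≤ d) :
    (s.factorial * (n + d - s).factorial : ℂ) * (c * (1 + C a * X) ^ n).coeff s
      = n.factorial * a ^ s * (coeffPoly a n d c).eval (s : ℂ) := by
  have hco : (c * (1 + C a * X) ^ n).coeff s = ∑ k ∈ range (d + 1),
      c.coeff k * if k ≤ s then n.choose (s - k) * a ^ (s - k) else 0 := by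
    conv_lhs => rw [as_sum_range' c (d + 1) (Nat.lt_succ_of_le hc)]
    rw [sum_mul, finsetSum_coeff]
    refine sum_congr rfl fun k _ => ?_
    rw [← C_mul_X_pow_eq_monomial, mul_assoc, coeff_C_mul, coeff_X_pow_mul']
    simp only [coeff_one_add_C_mul_X_pow]
  rw [hco, coeffPoly, eval_finsetSum, mul_sum, mul_sum]
  refine sum_congr rfl fun k hk => ?_
  have hkd : k ≤ d := Nat.lt_succ_iff.1 (mem_range.1 hk)
  rw [eval_mul, eval_mul, eval_C, eval_comp, eval_sub, eval_C, eval_X, ← Nat.cast_sub hs,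
    descPochhammer_eval_eq_descFactorial, descPochhammer_eval_eq_descFactorial]
  split_ifs with hks
  · have h := congrArg (Nat.cast (R := ℂ)) (factorial_mul_choose_sub hs hkd hks)
    push_cast at h
    have hak : a ^ s = a ^ (s - k) * a ^ k := by rw [← pow_add, Nat.sub_add_cancel hks]
    rw [hak]
    have := pow_ne_zero k ha
    field_simp
    linear_combination (c.coeff k) * h
  · rw [Nat.descFactorial_of_lt (not_le.1 hks)]
    simp

theorem taylor_coeff_X_pow_mul (a : ℂ) (n N M : ℕ) {A : ℂ[X]} (hA : A.natDegree ≤ M) :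
    a ^ n * (taylor a (X ^ N * A)).coeff n
      = ∑ s ∈ range (M + 1), A.coeff s * ((s + N).choose n * a ^ (s + N)) := by
  rw [taylor_coeff]
  conv_lhs => rw [as_sum_range' A (M + 1) (Nat.lt_succ_of_le hA)]
  rw [mul_sum, map_sum, eval_finsetSum, mul_sum]
  refine sum_congr rfl fun s _ => ?_
  rw [X_pow_mul_monomial, hasseDeriv_monomial, eval_monomial]
  rcases le_or_gt n (s + N) with h | h
  · rw [show a ^ (s + N) = a ^ n * a ^ (s + N - n) by rw [← pow_add, Nat.add_sub_cancel' h]]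
    ring
  · rw [Nat.choose_eq_zero_of_lt h]
    simp

/-- A Toeplitz system with symbol `(1 + a z) ^ n (1 - a / z) ^ (-n - 1)` is non-degenerate:
the Gram form is positive definite. -/
theorem eq_zero_of_taylor_coeff_eq_zero {a : ℝ} (ha : 0 < a) {n l d : ℕ} (hn : l + d = n)
    {c : ℂ[X]} (hc : c.natDegree ≤ d)
    (h : ∀ i ≤ d, (taylor (a : ℂ) (X ^ (l + i) * (c * (1 + C (a : ℂ) * X) ^ n))).coeff n = 0) :
    c = 0 := by
  have ha' : (a : ℂ) ≠ 0 := by exact_mod_cast ha.ne'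
  set A : ℂ[X] := c * (1 + C (a : ℂ) * X) ^ n with hA
  have hφ : (1 + C (a : ℂ) * X : ℂ[X]).natDegree ≤ 1 := by
    refine (natDegree_add_le _ _).trans ?_
    simpa using natDegree_C_mul_le (a : ℂ) (X : ℂ[X])
  have hAdeg : A.natDegree ≤ n + d := by
    refine natDegree_mul_le.trans ?_
    have := (natDegree_pow_le (p := (1 + C (a : ℂ) * X : ℂ[X])) (n := n)).trans
      (Nat.mul_le_mul_left n hφ)
    omega
  set R : ℂ[X] := coeffPoly a n d c with hR
  -- The weight collects the factorials and powers of a that both coefficient identities leave over.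
  set ω : ℕ → ℝ := fun s => a ^ (2 * s) * (s + l).factorial /
    (s.factorial * s.factorial * (n + d - s).factorial) with hω
  -- This is the polynomial part of the binomial coefficient for i = d - k; its factor
  -- s(s-1)⋯(s-k+1) vanishes at s < k, which gives triangularity.
  set Q : ℕ → ℂ[X] := fun k => (descPochhammer ℂ (d - k)).comp (X + C ((l + (d - k) : ℕ) : ℂ)) *
    descPochhammer ℂ k with hQ
  have hQeval : ∀ k s : ℕ, (Q k).eval (s : ℂ)
      = (s + l + (d - k)).descFactorial (d - k) * s.descFactorial k := by
    intro k s
    simp only [hQ, eval_mul, eval_comp, eval_add, eval_X, eval_C]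
    rw [← Nat.cast_add, descPochhammer_eval_eq_descFactorial, descPochhammer_eval_eq_descFactorial,
      add_assoc]
  have horth : ∀ k ≤ d, ∑ s ∈ range (n + d + 1), (ω s : ℂ) * R.eval (s : ℂ) * (Q k).eval (s : ℂ)
      = 0 := by
    intro k hk
    have h1 := taylor_coeff_X_pow_mul (a : ℂ) n (l + (d - k)) (n + d) hAdeg
    rw [h (d - k) (Nat.sub_le _ _), mul_zero] at h1
    have h2 : (a : ℂ) ^ (l + (d - k)) * ∑ s ∈ range (n + d + 1),
        (ω s : ℂ) * R.eval (s : ℂ) * (Q k).eval (s : ℂ) = 0 := by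
      rw [h1, mul_sum]
      refine sum_congr rfl fun s hs => ?_
      have e1 := factorial_mul_coeff_eq ha' (Nat.lt_succ_iff.1 (mem_range.1 hs)) hc
      have e2 := congrArg (Nat.cast (R := ℂ))
        (factorial_mul_choose_add (s := s) hn (Nat.sub_le d k))
      rw [Nat.sub_sub_self hk] at e2
      push_cast at e2
      rw [hQeval, hω, ← add_assoc s]
      push_cast
      have f1 : (n.factorial : ℂ) ≠ 0 := by exact_mod_cast n.factorial_ne_zero
      have f2 : (s.factorial : ℂ) ≠ 0 := by exact_mod_cast s.factorial_ne_zero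
      have f3 : ((n + d - s).factorial : ℂ) ≠ 0 := by exact_mod_cast (n + d - s).factorial_ne_zero
      rw [← hA, ← hR] at e1
      have e3 : A.coeff s = n.factorial * a ^ s * R.eval (s : ℂ) /
          (s.factorial * (n + d - s).factorial) := by
        rw [eq_div_iff (mul_ne_zero f2 f3), ← e1]
        ring
      have e4 : ((s + l + (d - k)).choose n : ℂ) = (s + l).factorial *
          ((s + l + (d - k)).descFactorial (d - k) * s.descFactorial k) /
          (n.factorial * s.factorial) := by
        rw [eq_div_iff (mul_ne_zero f1 f2), ← e2]
        ring
      rw [e3, e4]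
      field_simp
      ring
    exact (mul_eq_zero.1 h2).resolve_left (pow_ne_zero _ ha')
  have hdeg : ∀ k : Fin (d + 1), (Q k).natDegree ≤ d := by
    intro k
    refine natDegree_mul_le.trans ?_
    have h1 := natDegree_comp_le (p := descPochhammer ℂ (d - k))
      (q := X + C ((l + (d - k) : ℕ) : ℂ))
    rw [natDegree_X_add_C, descPochhammer_natDegree] at h1
    rw [descPochhammer_natDegree]
    omega
  have hlow : ∀ k s : Fin (d + 1), s < k → (Q k).eval ((s : ℕ) : ℂ) = 0 := by
    intro k s hsk
    rw [hQeval, Nat.descFactorial_of_lt (show (s : ℕ) < k from hsk)]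
    simp
  have hdiag : ∀ k : Fin (d + 1), (Q k).eval ((k : ℕ) : ℂ) ≠ 0 := by
    intro k
    rw [hQeval, ← Nat.cast_mul, Nat.cast_ne_zero]
    refine mul_ne_zero ?_ ?_ <;>
    · rw [Ne, Nat.descFactorial_eq_zero_iff_lt]
      omega
  -- The `Q k` span the polynomials of degree at most d, so R, being orthogonal to all of them, is
  -- orthogonal to its own conjugate.
  obtain ⟨x, hx⟩ := exists_eq_sum_of_eval_triangular (fun k : Fin (d + 1) => Q k) hdeg hlow hdiag
    (R.map (starRingEnd ℂ)) (natDegree_map_le.trans (natDegree_coeffPoly_le _ _ _ _))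
  have hnorm : ∑ s ∈ range (n + d + 1), ω s * ‖R.eval (s : ℂ)‖ ^ 2 = 0 := by
    have : ((∑ s ∈ range (n + d + 1), ω s * ‖R.eval (s : ℂ)‖ ^ 2 : ℝ) : ℂ)
        = ∑ k : Fin (d + 1), x k * ∑ s ∈ range (n + d + 1),
          (ω s : ℂ) * R.eval (s : ℂ) * (Q k).eval (s : ℂ) := by
      simp only [mul_sum]
      rw [sum_comm, ofReal_sum]
      refine sum_congr rfl fun s _ => ?_
      rw [ofReal_mul, ofReal_pow, ← Complex.mul_conj', ← eval_natCast_map, hx, eval_finsetSum,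
        mul_sum, mul_sum]
      refine sum_congr rfl fun k _ => ?_
      rw [eval_mul, eval_C]
      ring
    rw [← ofReal_eq_zero, this]
    exact sum_eq_zero fun k _ => by rw [horth k (Nat.lt_succ_iff.1 k.2), mul_zero]
  have hωpos : ∀ s, 0 < ω s := fun s => by positivity
  rw [sum_eq_zero_iff_of_nonneg fun s _ => mul_nonneg (hωpos s).le (sq_nonneg _)] at hnorm
  have hA0 : A = 0 := by
    ext s
    rw [coeff_zero]
    rcases lt_or_ge (n + d) s with hs | hs
    · exact coeff_eq_zero_of_natDegree_lt (hAdeg.trans_lt hs)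
    · have h3 := hnorm s (mem_range.2 (Nat.lt_succ_of_le hs))
      have h4 : R.eval (s : ℂ) = 0 := by
        simpa [(hωpos s).ne'] using h3
      have h5 := factorial_mul_coeff_eq ha' hs hc
      rw [← hA, ← hR, h4, mul_zero] at h5
      refine (mul_eq_zero.1 h5).resolve_left (mul_ne_zero ?_ ?_) <;>
      exact_mod_cast Nat.factorial_ne_zero _
  rcases mul_eq_zero.1 hA0 with h6 | h6
  · exact h6
  · have := congrArg (eval (0 : ℂ)) h6
    simp at this

/-! ### Invertibility of 1 - K_n. -/

theorem oneSubInvertible_of_block {K : ℤ → ℤ → ℂ} {N : ℤ} {l : ℕ}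
    (hK : ∀ j k, N + l ≤ k → K j k = 0)
    (hinj : ∀ g : Fin l → ℂ, (∀ j : Fin l, g j = ∑ k : Fin l, K (N + j) (N + k) * g k) → g = 0) :
    OneSubInvertible K N := by
  set e : Fin l → Set.Ici N := fun k => ⟨N + k, by simp⟩ with he
  have hinj_e : Function.Injective e := by
    intro i j hij
    have : N + (i : ℤ) = N + (j : ℤ) := congrArg Subtype.val hij
    exact Fin.ext (by omega)
  -- Only the first l columns are nonzero, so every row sum is finite; the first l entries of g
  -- solve a square system and determine the rest.
  have hiff : ∀ f g : Set.Ici N → ℂ, IsResolventImage K N f g ↔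
      ∀ j : Set.Ici N, g j - f j = ∑ k : Fin l, K j (N + k) * g (e k) := by
    intro f g
    refine forall_congr' fun j => ?_
    rw [← hinj_e.hasSum_iff]
    · have h0 := hasSum_fintype ((fun k : Set.Ici N => K j k * g k) ∘ e)
      exact ⟨fun h => h.unique h0, fun h => by rw [h]; exact h0⟩
    · intro k hk
      rw [hK, zero_mul]
      by_contra! hlt
      have hk0 : N ≤ k := k.2
      exact hk ⟨⟨((k : ℤ) - N).toNat, by omega⟩, Subtype.ext (by simp only [he]; omega)⟩
  set B : Matrix (Fin l) (Fin l) ℂ :=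
    1 - Matrix.of fun j k : Fin l => K (N + (j : ℕ)) (N + (k : ℕ)) with hB
  have hBv : ∀ v j, B.mulVec v j = v j - ∑ k : Fin l, K (N + j) (N + k) * v k := by
    intro v j
    rw [hB, Matrix.sub_mulVec, Matrix.one_mulVec]
    rfl
  have hBinj : Function.Injective B.mulVec := by
    intro v w hvw
    have : v - w = 0 := hinj _ fun j => by
      have h1 := congrFun hvw j
      rw [hBv, hBv] at h1
      simp only [Pi.sub_apply, mul_sub, sum_sub_distrib]
      linear_combination h1
    exact sub_eq_zero.1 this
  have hBsurj : Function.Surjective B.mulVec :=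
    Matrix.mulVec_surjective_iff_isUnit.2 (Matrix.mulVec_injective_iff_isUnit.1 hBinj)
  intro f
  obtain ⟨v, hv⟩ := hBsurj fun k => f (e k)
  have hg : ∀ k, f (e k) + ∑ k' : Fin l, K (e k) (N + k') * v k' = v k := by
    intro k
    have := congrFun hv k
    rw [hBv] at this
    rw [← this]
    simp only [he]
    ring
  refine ⟨fun j => f j + ∑ k : Fin l, K j (N + k) * v k, ?_, ?_⟩
  · refine (hiff _ _).2 fun j => ?_
    simp only [hg]
    ring
  · intro g' hg'
    rw [hiff] at hg'
    have hgv : (fun k => g' (e k)) = v := by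
      refine hBinj (hv.trans ?_).symm
      funext j
      rw [hBv]
      have := hg' (e j)
      simp only [he] at this ⊢
      linear_combination -this
    funext j
    have := hg' j
    simp only [← hgv]
    linear_combination this

variable {a : ℝ}

theorem innerInt_sum (ha : 0 < a) {ι : Type*} (s : Finset ι) {F : ι → ℂ → ℂ}
    (hF : ∀ i, ContinuousOn (F i) (ann a)) :
    innerInt a (fun z => ∑ i ∈ s, F i z) = ∑ i ∈ s, innerInt a (F i) := by
  classical
  induction s using Finset.induction_on with
  | empty => simp [innerInt, circleIntegral]
  | insert i s hi ih =>
    simp only [sum_insert hi]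
    rw [innerInt_add ha (hF i) (continuousOn_finsetSum _ fun i _ => hF i), ih]

theorem hasSplit_sum {ι : Type*} (s : Finset ι) (c : ι → ℂ) {F : ι → ℂ → ℂ}
    (hF : ∀ i, HasSplit a (F i)) : HasSplit a fun z => ∑ i ∈ s, c i * F i z := by
  classical
  induction s using Finset.induction_on with
  | empty => exact IsInner.hasSplit ⟨_, InnerHol.zero, fun _ _ => by simp⟩
  | insert i s hi ih =>
    simp only [sum_insert hi]
    exact (hF i).mul_add ih (c i)

theorem pairing_left_sum (ha : 0 < a) {ι : Type*} (s : Finset ι) (c : ι → ℂ) {F : ι → ℂ → ℂ}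
    {G : ℂ → ℂ} (hF : ∀ i, HasSplit a (F i)) (hG : HasSplit a G) :
    pairing a (fun z => ∑ i ∈ s, c i * F i z) G = ∑ i ∈ s, c i * pairing a (F i) G := by
  classical
  induction s using Finset.induction_on with
  | empty =>
    simp only [sum_empty]
    exact pairing_left_outer ha ⟨_, OuterHol.zero, fun _ _ => rfl⟩ G
  | insert i s hi ih =>
    simp only [sum_insert hi]
    rw [pairing_left_add ha (hF i) (hasSplit_sum s c hF) hG, ih]

theorem continuousOn_sub_zpow (ha : 0 < a) (i : ℤ) :
    ContinuousOn (fun z : ℂ => (z - a) ^ i) (ann a) := fun z hz =>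
  ContinuousWithinAt.zpow₀ (by fun_prop) i (Or.inl (ann_sub_ne_zero ha hz))

/-- Residue at a of the Taylor expansion about a. -/
theorem innerInt_eval_mul_sub_zpow (ha : 0 < a) (n : ℕ) (q : ℂ[X]) :
    innerInt a (fun z => q.eval z * (z - a) ^ (-((n : ℤ) + 1))) = (taylor (a : ℂ) q).coeff n := by
  have hq : ∀ z ∈ ann a, q.eval z * (z - a) ^ (-((n : ℤ) + 1))
      = ∑ i ∈ (taylor (a : ℂ) q).support,
        (taylor (a : ℂ) q).coeff i * (z - a) ^ ((i : ℤ) - (n + 1)) := by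
    intro z hz
    conv_lhs => rw [← sum_taylor_eq q (a : ℂ)]
    rw [Polynomial.sum, eval_finsetSum, sum_mul]
    refine sum_congr rfl fun i _ => ?_
    rw [eval_mul, eval_C, eval_pow, eval_sub, eval_X, eval_C, sub_eq_add_neg (i : ℤ),
      zpow_add₀ (ann_sub_ne_zero ha hz), zpow_natCast]
    ring
  rw [innerInt_congr ha hq, innerInt_sum ha _ fun i =>
    continuousOn_const.fun_mul (continuousOn_sub_zpow ha _)]
  simp only [innerInt_const_mul, innerInt_sub_zpow ha (self_mem_closedBall ha)]
  rw [sum_eq_single n]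
  · rw [if_pos (by ring), mul_one]
  · intro i _ hi
    rw [if_neg (by omega), mul_zero]
  · intro h
    rw [notMem_support_iff.1 h, zero_mul]

theorem innerHol_eval (q : ℂ[X]) : InnerHol a fun z => q.eval z :=
  q.differentiable.differentiableOn

theorem outerHol_polynomial (ha : 0 < a) {l : ℕ} (c : ℕ → ℂ) :
    OuterHol a fun z => ∑ k ∈ range l, c k * z ^ ((k : ℤ) - l) := by
  constructor
  · refine DifferentiableOn.fun_sum fun k _ => DifferentiableOn.const_mul (fun z hz => ?_) _
    refine (differentiableAt_id.zpow (Or.inl ?_)).differentiableWithinAt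
    rintro rfl
    exact hz (zero_mem_closedBall ha)
  · refine Asymptotics.IsBigO.fun_sum fun k hk => Asymptotics.IsBigO.const_mul_left ?_ _
    have := mem_range.1 hk
    simpa using zpow_isBigO_zpow (show (k : ℤ) - l ≤ -1 by omega)

theorem isCoprime_one_add_X_sub (ha : 0 < a) :
    IsCoprime (1 + C (a : ℂ) * X : ℂ[X]) (X - C (a : ℂ)) := by
  have h0 : (1 + (a : ℂ) * a) ≠ 0 := by
    exact_mod_cast (by positivity : (1 + a * a : ℝ) ≠ 0)
  refine ⟨C (1 + (a : ℂ) * a)⁻¹, C ((1 + (a : ℂ) * a)⁻¹ * -a), ?_⟩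
  rw [show C (1 + (a : ℂ) * a)⁻¹ * (1 + C (a : ℂ) * X) + C ((1 + (a : ℂ) * a)⁻¹ * -a) * (X - C (a : ℂ))
      = C ((1 + (a : ℂ) * a)⁻¹ * (1 + a * a)) by
    simp only [map_mul, map_add, map_neg, map_one]; ring, inv_mul_cancel₀ h0, map_one]

theorem isCoprime_X_one_add : IsCoprime (X : ℂ[X]) (1 + C (a : ℂ) * X) :=
  ⟨-C (a : ℂ), 1, by ring⟩

theorem isCoprime_X_X_sub (ha : 0 < a) : IsCoprime (X : ℂ[X]) (X - C (a : ℂ)) := by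
  have ha' : (a : ℂ) ≠ 0 := by exact_mod_cast ha.ne'
  refine ⟨C (a : ℂ)⁻¹, -C (a : ℂ)⁻¹, ?_⟩
  rw [show C (a : ℂ)⁻¹ * X + -C (a : ℂ)⁻¹ * (X - C (a : ℂ)) = C (a : ℂ)⁻¹ * C (a : ℂ) by ring,
    ← C_mul, inv_mul_cancel₀ ha', C_1]

theorem taylor_coeff_eq_zero_of_dvd {r : ℂ} {n : ℕ} {q : ℂ[X]} (h : (X - C r) ^ (n + 1) ∣ q) :
    (taylor r q).coeff n = 0 := by
  obtain ⟨w, rfl⟩ := h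
  rw [taylor_mul, taylor_pow, map_sub, taylor_X, taylor_C, add_sub_cancel_right, coeff_X_pow_mul',
    if_neg (by omega)]

/-- The algebraic heart of the invertibility of `1 - K_n`. -/
theorem eq_zero_of_innerInt_eq_zero (ha : 0 < a) {n l d : ℕ} (hn : l + d = n) {p H h : ℂ[X]}
    (hp : p.degree < l) (hh : h.degree < l)
    (hdec : p * ((1 + C (a : ℂ) * X) ^ n * (X - C (a : ℂ)) ^ (n + 1)) = h + X ^ l * H)
    (hint : ∀ t < l, innerInt a (fun z =>
      H.eval z * z ^ t * (1 + a * z) ^ (-(n : ℤ)) * (z - a) ^ (-((n : ℤ) + 1))) = 0) :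
    p = 0 := by
  obtain ⟨u, v, huv⟩ := (isCoprime_one_add_X_sub ha).pow (m := n) (n := n + 1)
  have hmonic : ((X - C (a : ℂ)) ^ (n + 1) : ℂ[X]).Monic := (monic_X_sub_C _).pow _
  have hdegψ : ((X - C (a : ℂ)) ^ (n + 1) : ℂ[X]).natDegree = n + 1 := by
    rw [natDegree_pow, natDegree_X_sub_C, mul_one]
  set φ : ℂ[X] := (1 + C (a : ℂ) * X) ^ n with hφ
  set ψ : ℂ[X] := (X - C (a : ℂ)) ^ (n + 1) with hψ
  set c : ℂ[X] := (u * H) %ₘ ψ with hc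
  have hcdeg : c.natDegree ≤ n := by
    have hψ1 : ψ ≠ 1 := fun h1 => by
      rw [h1, natDegree_one] at hdegψ
      omega
    have : c.natDegree < ψ.natDegree := natDegree_modByMonic_lt (u * H) hmonic hψ1
    omega
  -- Modulo ψ, the polynomial `u` inverts φ, so `c` represents H / φ.
  obtain ⟨w, hw⟩ : ψ ∣ H - c * φ := by
    have h1 := modByMonic_add_div (u * H) ψ
    rw [← hc] at h1
    refine ⟨(u * H /ₘ ψ) * φ + v * H, ?_⟩
    linear_combination (-H) * huv - φ * h1
  -- H/φ differs from c by wψ/φ; after division by ψ this is holomorphic inside the contour and does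
  -- not contribute.
  have hct : ∀ t < l, (taylor (a : ℂ) (c * X ^ t)).coeff n = 0 := by
    intro t ht
    rw [← innerInt_eval_mul_sub_zpow ha, ← hint t ht]
    have hin : InnerHol a fun z => w.eval z * z ^ t * (1 + a * z) ^ (-(n : ℤ)) := by
      have := ((innerHol_eval (a := a) (w * X ^ t)).mul (innerHol_one_add_zpow ha (-(n : ℤ))))
      simpa using this
    have hcont : ContinuousOn (fun z : ℂ => (c * X ^ t).eval z * (z - a) ^ (-((n : ℤ) + 1)))
        (ann a) := (innerHol_eval _).continuousOn.fun_mul (continuousOn_sub_zpow ha _)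
    have hadd := innerInt_add ha hcont hin.continuousOn
    rw [innerInt_inner ha hin, add_zero] at hadd
    rw [← hadd]
    refine innerInt_congr ha fun z hz => ?_
    have hev := congrArg (eval z) hw
    simp only [eval_sub, eval_mul, hφ, hψ, eval_pow, eval_add, eval_one, eval_C, eval_X] at hev
    have n1 := pow_ne_zero n (ann_one_add_ne_zero ha hz)
    have n2 := pow_ne_zero (n + 1) (ann_sub_ne_zero ha hz)
    have e3 : (z - a) ^ (-((n : ℤ) + 1)) = ((z - a) ^ (n + 1))⁻¹ := by
      rw [zpow_neg]
      norm_cast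
    rw [e3, zpow_neg, zpow_natCast, eval_mul, eval_pow, eval_X]
    generalize (z - a) ^ (n + 1) = P₁ at *
    generalize (1 + a * z) ^ n = P₂ at *
    field_simp
    linear_combination (-z ^ t) * hev
  -- If e = deg c > d, then t = n - e is less than l and c X^t has degree n. Its n-th Taylor
  -- coefficient is the leading coefficient of c, yet it vanishes.
  have hcd : c.natDegree ≤ d := by
    by_contra! hlt
    have h1 := hct (n - c.natDegree) (by omega)
    have hc0 : c ≠ 0 := by
      rintro h0
      rw [h0, natDegree_zero] at hlt
      omega
    have h2 : (c * X ^ (n - c.natDegree)).natDegree = n := by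
      rw [natDegree_mul_X_pow _ hc0]
      omega
    have h3 := coeff_taylor_natDegree (a : ℂ) (c * X ^ (n - c.natDegree))
    rw [h2, h1, eq_comm, leadingCoeff_mul_X_pow, leadingCoeff_eq_zero] at h3
    exact hc0 h3
  have hdvd : ψ ∣ X ^ l * (c * φ) + h := by
    refine ⟨p * φ - X ^ l * w, ?_⟩
    linear_combination (-X ^ l) * hw + -hdec
  -- The remainder h is too short to reach the n-th coefficient, so the divisibility by (X -
  -- a)^(n+1) leaves the Toeplitz equations for c alone.
  have hdegh : ∀ i ≤ d, (X ^ i * h).degree < (n : WithBot ℕ) := by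
    intro i hi
    rw [degree_mul, degree_X_pow]
    calc (i : WithBot ℕ) + h.degree < i + l :=
          WithBot.add_lt_add_left (WithBot.coe_ne_bot) hh
      _ ≤ n := by exact_mod_cast (by omega : i + l ≤ n)
  have hc0 : c = 0 := by
    refine eq_zero_of_taylor_coeff_eq_zero ha hn hcd fun i hi => ?_
    have h1 : ψ ∣ X ^ i * (X ^ l * (c * φ) + h) := dvd_mul_of_dvd_right hdvd _
    have h2 := taylor_coeff_eq_zero_of_dvd h1
    rw [mul_add, map_add, coeff_add, coeff_eq_zero_of_degree_lt
      (show (taylor (a : ℂ) (X ^ i * h)).degree < (n : WithBot ℕ) by rw [degree_taylor]; exact hdegh i hi),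
      add_zero] at h2
    rw [pow_add, mul_comm (X ^ l), mul_assoc]
    exact h2
  have hh0 : h = 0 := by
    rw [hc0, zero_mul, mul_zero, zero_add] at hdvd
    refine eq_zero_of_dvd_of_degree_lt hdvd ?_
    rw [degree_eq_natDegree hmonic.ne_zero, hdegψ]
    exact hh.trans_le (by exact_mod_cast (by omega : l ≤ n + 1))
  -- With h = 0, X^l divides p φ ψ and is coprime to φ ψ; but deg p < l.
  have hX : (X ^ l : ℂ[X]) ∣ p := by
    have hcop : IsCoprime (X ^ l : ℂ[X]) (φ * ψ) :=
      (isCoprime_X_one_add.pow).mul_right (isCoprime_X_X_sub ha).pow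
    refine hcop.dvd_of_dvd_mul_right (Dvd.intro H ?_)
    rw [hdec, hh0, zero_add]
  exact eq_zero_of_dvd_of_degree_lt hX (by rwa [degree_X_pow])

/-- A null vector g gives F = ∑ g_k col_k orthogonal to the l row functions. Since z^l F is a
polynomial P on the annulus, division of P by X^l yields the Laurent splitting: the quotient is the
inner part, the remainder over z^l the outer part. -/
theorem Kn_block_injective (ha : 0 < a) {n m l : ℕ} (hn : l + 2 * m = n) (g : Fin l → ℂ)
    (hg : ∀ j : Fin l, g j = ∑ k : Fin l, Kn a n (2 * m + 1 + j) (2 * m + 1 + k) * g k) :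
    g = 0 := by
  rcases Nat.eq_zero_or_pos l with rfl | hl
  · exact Subsingleton.elim _ _
  set p : ℂ[X] := ∑ k : Fin l, monomial (k : ℕ) ((-1) ^ (2 * (m : ℤ) + 1 + (k : ℕ)) * g k) with hp
  set P : ℂ[X] := p * ((1 + C (a : ℂ) * X) ^ n * (X - C (a : ℂ)) ^ (n + 1)) with hP
  set h : ℂ[X] := P %ₘ X ^ l with hh
  set H : ℂ[X] := P /ₘ X ^ l with hH
  have hmonic : (X ^ l : ℂ[X]).Monic := monic_X_pow l
  have hdec : P = h + X ^ l * H := (modByMonic_add_div P (X ^ l)).symm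
  have hhdeg : h.degree < l := by
    simpa using degree_modByMonic_lt P hmonic
  have hpdeg : p.degree < l := by
    refine (degree_sum_le _ _).trans_lt ((Finset.sup_lt_iff (WithBot.bot_lt_coe _)).2 fun k _ => ?_)
    exact (degree_monomial_le _ _).trans_lt (by exact_mod_cast k.2)
  set F : ℂ → ℂ := fun z => ∑ k : Fin l, g k * colFun a n (2 * m + 1 + (k : ℕ)) z with hF
  have hsplit : Splits a F (fun z => H.eval z)
      (fun z => ∑ k ∈ range l, h.coeff k * z ^ ((k : ℤ) - l)) := by
    refine ⟨innerHol_eval H, outerHol_polynomial ha _, fun z hz => ?_⟩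
    have hz0 := ann_ne_zero ha hz
    have e1 : F z = z ^ (-(l : ℤ)) * P.eval z := by
      simp only [hF, hP, hp, eval_mul, eval_finsetSum, eval_monomial, eval_pow, eval_add, eval_sub,
        eval_one, eval_C, eval_X]
      rw [sum_mul, mul_sum]
      refine sum_congr rfl fun k _ => ?_
      unfold colFun
      rw [mono_eq ha hz, show 2 * (m : ℤ) + 1 + (k : ℕ) - (n + 1) = -l + (k : ℕ) by omega,
        zpow_add₀ hz0, zpow_natCast, zpow_natCast,
        show (z - a) ^ ((n : ℤ) + 1) = (z - a) ^ (n + 1) by norm_cast]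
      ring
    have e2 : h.eval z = ∑ k ∈ range l, h.coeff k * z ^ k := by
      have hnat : h.natDegree < l := by
        by_cases h0 : h = 0
        · simpa [h0] using hl
        · exact (natDegree_lt_iff_degree_lt h0).2 hhdeg
      exact eval_eq_sum_range' hnat z
    rw [e1, hdec, eval_add, e2, mul_add, eval_mul, eval_pow, eval_X, zpow_neg, zpow_natCast,
      inv_mul_cancel_left₀ (pow_ne_zero _ hz0), mul_sum, add_comm]
    congr 1
    refine sum_congr rfl fun k _ => ?_
    rw [zpow_sub₀ hz0, zpow_natCast, zpow_natCast]
    ring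
  have hrow : ∀ j : Fin l, pairing a F (rowFun a n (2 * m + 1 + (j : ℕ))) = 0 := by
    intro j
    rw [hF, pairing_left_sum ha _ _ (fun k => colFun_hasSplit ha n _) (rowFun_hasSplit ha n _)]
    have hk : ∀ k : Fin l, pairing a (colFun a n (2 * m + 1 + (k : ℕ)))
        (rowFun a n (2 * m + 1 + (j : ℕ)))
        = (if j = k then 1 else 0) - Kn a n (2 * m + 1 + (j : ℕ)) (2 * m + 1 + (k : ℕ)) := by
      intro k
      have h1 := pairing_add_pairing ha (rowFun_hasSplit ha n (2 * m + 1 + (j : ℕ)))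
        (colFun_hasSplit ha n (2 * m + 1 + (k : ℕ)))
      rw [innerInt_rowFun_colFun ha, ← Kn_eq ha] at h1
      have h2 : (2 * (m : ℤ) + 1 + (j : ℕ) = 2 * m + 1 + (k : ℕ)) ↔ j = k := by
        rw [Fin.ext_iff]
        omega
      simp only [h2] at h1
      linear_combination h1
    simp only [hk, mul_sub, sum_sub_distrib, mul_ite, mul_one, mul_zero, sum_ite_eq, mem_univ,
      if_true]
    rw [sub_eq_zero, hg j]
    exact sum_congr rfl fun k _ => mul_comm _ _
  have hp0 : p = 0 := by
    refine eq_zero_of_innerInt_eq_zero ha hn hpdeg hhdeg hdec fun t ht => ?_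
    -- With this index, and l + 2m = n, the row function contributes exactly the power z^t.
    have h1 := hrow ⟨l - 1 - t, by omega⟩
    rw [hsplit.pairing_eq ha] at h1
    rw [← mul_zero ((-1 : ℂ) ^ (2 * (m : ℤ) + 1 + (l - 1 - t : ℕ))), ← h1, ← innerInt_const_mul]
    refine innerInt_congr ha fun z hz => ?_
    unfold rowFun
    rw [mono_eq ha hz, show -(2 * (m : ℤ) + 1 + (l - 1 - t : ℕ)) - 1 - -((n : ℤ) + 1) = t by omega,
      zpow_natCast]
    linear_combination (-(H.eval z * z ^ t * (1 + a * z) ^ (-(n : ℤ)) *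
      (z - a) ^ (-((n : ℤ) + 1)))) * neg_one_zpow_mul_self (2 * (m : ℤ) + 1 + (l - 1 - t : ℕ))
  funext k
  have h1 : p.coeff k = (-1) ^ (2 * (m : ℤ) + 1 + (k : ℕ)) * g k := by
    rw [hp, finsetSum_coeff]
    simp only [coeff_monomial, Fin.val_inj, sum_ite_eq', mem_univ, if_true]
  rw [hp0, coeff_zero] at h1
  exact (mul_eq_zero.1 h1.symm).resolve_left (zpow_ne_zero _ (by norm_num))

theorem oneSubInvertible_Kn (ha : 0 < a) {n m : ℕ} (hmn : 2 * m ≤ n) :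
    OneSubInvertible (Kn a n) (2 * (m : ℤ) + 1) := by
  obtain ⟨l, rfl⟩ := Nat.exists_eq_add_of_le hmn
  refine oneSubInvertible_of_block (l := l) (fun j k hk => Kn_eq_zero ha j ?_)
    (Kn_block_injective ha (add_comm _ _))
  push_cast
  omega

end DoubleAztec

theorem theorem2p3 (n ρ m : ℕ) (hρ : (n : ℤ) - (ρ : ℤ) = 2 * (m : ℤ)) (a : ℝ) (ha : 0 < a) :
    DoubleAztec.OneSubInvertible (DoubleAztec.Kn a n) (2 * (m : ℤ) + 1) ∧
    (∀ b ∈ DoubleAztec.blackAD n m, ∀ w ∈ DoubleAztec.whiteAD n m,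
      Summable (DoubleAztec.pairingTerm a n m
        (DoubleAztec.zCoord b) (DoubleAztec.xCoord m b)
        (DoubleAztec.zCoord w) (DoubleAztec.xCoord m w))) ∧
    DoubleAztec.kasteleyn a n m * DoubleAztec.kernelMatrix a n m = 1 ∧
    DoubleAztec.kernelMatrix a n m * DoubleAztec.kasteleyn a n m = 1 := by
  -- The inequality 2m ≤ n is ρ ≥ 0.
  have hK := DoubleAztec.oneSubInvertible_Kn ha (show 2 * m ≤ n by omega)
  exact ⟨hK, fun b hb w hw => DoubleAztec.summable_pairingTerm ha hK hb hw,
    DoubleAztec.kasteleyn_mul_kernelMatrix ha hK, DoubleAztec.kernelMatrix_mul_kasteleyn ha hK⟩
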